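/- Let $\mathbb{S}^1=\{z\in\mathbb{C}:|z|=1\}$, $\mathbb{T}^k=(\mathbb{S}^1)^k$, $\mathbb{D}=\{z\in\mathbb{C}:|z|\le 1\}$, let $\mathcal{T}=\mathbb{T}^k\times\mathbb{D}$ be the solid $k$-torus, and let $B^{n}=\{x\in\mathbb{R}^n:\sum_i x_i^2<1\}$. For $\Theta=(\theta_1,\dots,\theta_k)\in\mathbb{T}^k$ write $\Theta^2=(\theta_1^2,\dots,\theta_k^2)$. For every integer $k\ge 1$ and every $\lambda\in(0,1)$ the following holds. There exist maps $A_\Theta:\mathbb{D}\to\mathbb{D}$, $\Theta\in\mathbb{T}^k$, each a contraction with contraction rate at most $\lambda$ (that is, $|A_\Theta(z)-A_\Theta(w)|\le\lambda|z-w|$) and with image in the open unit disk, such that the solenoid map $$s:\mathcal{T}\to\mathcal{T},\qquad s(\Theta,z)=(\Theta^2,A_\Theta(z)),$$ is a $C^\infty$ embedding, and there exist a $C^\infty$ embedding $e:\mathcal{T}\to B^{k+2}$ and a map $S:e(\mathcal{T})\to e(\mathcal{T})$ with $S\circ e=e\circ s$. If $\tilde\pi:e(\mathcal{T})\to e(\mathbb{T}^k\times\{0\})$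 denotes the projection along the leaves of the foliation $\{e(\{\Theta\}\times\mathbb{D})\}_{\Theta\in\mathbb{T}^k}$ of $e(\mathcal{T})$, so that $\tilde\pi(w)=e(\Theta,0)$ for $w\in e(\{\Theta\}\times\mathbb{D})$, then $\tilde\pi(S(w))=e(\Theta^2,0)$ for all $\Theta\in\mathbb{T}^k$ and $w\in e(\{\Theta\}\times\mathbb{D})$. Moreover, there is a smooth isotopy from $e$ to $e\circ s$: a family $e_t:\mathcal{T}\to B^{k+2}$, $t\in[0,1]$, of $C^\infty$ embeddings such that $(t,p)\mapsto e_t(p)$ is $C^\infty$ on $[0,1]\times\mathcal{T}$, $e_0=e$ and $e_1=e\circ s$. -/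

import Mathlib

open Set Metric Topology
open scoped Manifold ContDiff

/-- The torus `𝕋^k = (𝕊¹)^k`, with the product manifold structure. -/
abbrev Torus (k : ℕ) : Type := Fin k → Circle

/-- The product atlas makes the torus a smooth manifold. -/
instance Torus.isManifold (k : ℕ) :
    IsManifold (ModelWithCorners.pi fun _ : Fin k => 𝓡 1) ∞ (Torus k) := by
  apply isManifold_of_contDiffOn
  rintro e e' ⟨f, hf, rfl⟩ ⟨f', hf', rfl⟩
  rw [contDiffOn_pi]
  intro i
  have h := (contDiffGroupoid ∞ (𝓡 1)).compatible (hf i (mem_univ i)) (hf' i (mem_univ i))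
  rw [contDiffGroupoid, mem_groupoid_of_pregroupoid] at h
  have h2 : ContDiffOn ℝ ∞ ((f i).symm ≫ₕ f' i) ((f i).symm ≫ₕ f' i).source := by
    simpa [contDiffPregroupoid] using h.1
  refine h2.comp (f := fun v : Fin k → EuclideanSpace ℝ (Fin 1) => v i)
    (contDiff_apply ℝ (EuclideanSpace ℝ (Fin 1)) i).contDiffOn ?_
  rintro v ⟨⟨h1, h3⟩, -⟩
  exact ⟨h1 i (mem_univ i), h3 i (mem_univ i)⟩

/-- The open unit ball `B^n` of Euclidean space `ℝ^n`. -/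
def openUnitBall (n : ℕ) : Set (EuclideanSpace ℝ (Fin n)) := ball 0 1

/-- The closed unit disk `𝔻` of the complex plane. -/
def closedUnitDisk : Set ℂ := closedBall 0 1

/-- The solid `k`-torus `𝕋^k × 𝔻`, as a domain with boundary in the manifold `𝕋^k × ℂ`. -/
def solidTorus (k : ℕ) : Set (Torus k × ℂ) := univ ×ˢ closedUnitDisk

/-- The model with corners of the (real) manifold `𝕋^k × ℂ`. -/
noncomputable abbrev solidTorusModel (k : ℕ) :=
  (ModelWithCorners.pi fun _ : Fin k => 𝓡 1).prod 𝓘(ℝ, ℂ)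

section Embedding

variable {E₁ E₂ H₁ H₂ M N : Type*}
  [NormedAddCommGroup E₁] [NormedSpace ℝ E₁] [NormedAddCommGroup E₂] [NormedSpace ℝ E₂]
  [TopologicalSpace H₁] [TopologicalSpace H₂]
  [TopologicalSpace M] [ChartedSpace H₁ M] [TopologicalSpace N] [ChartedSpace H₂ N]

/-- `f` is a smooth embedding of the domain `s ⊆ M` into `N`: it is `C^∞` on `s` (up to the
boundary), its derivative at each point of `s` is injective, and its restriction to `s` is a
homeomorphism onto the image.  It is used for domains `s` in which every point is a limit of
interior points, so that the derivative within `s` is unique. -/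
structure IsSmoothEmbeddingOn (I : ModelWithCorners ℝ E₁ H₁) (J : ModelWithCorners ℝ E₂ H₂)
    (f : M → N) (s : Set M) : Prop where
  contMDiffOn : ContMDiffOn I J ∞ f s
  immersion : ∀ x ∈ s, Function.Injective (mfderivWithin I J f s x)
  embedding : IsEmbedding (s.domRestrict f)

end Embedding

/-- The expanding torus endomorphism `(θ₁, …, θ_k) ↦ (θ₁², …, θ_k²)`. -/
noncomputable def torusSquaring {k : ℕ} (Θ : Torus k) : Torus k := fun i => Θ i ^ 2

/-- The map `(Θ, z) ↦ (Θ², A_Θ(z))`. -/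
noncomputable def solenoidMap {k : ℕ} (A : Torus k → ℂ → ℂ) (p : Torus k × ℂ) : Torus k × ℂ :=
  (torusSquaring p.1, A p.1 p.2)

/-- The family `(A_Θ)` defines a Smale solenoid map `s(Θ, z) = (Θ², A_Θ(z))` on the solid torus:
every `A_Θ` is a contraction of the disk with rate at most `lam`, with image in the open disk,
and `s` is a smooth embedding. -/
structure IsSmaleSolenoid {k : ℕ} (lam : ℝ) (A : Torus k → ℂ → ℂ) : Prop where
  mapsTo : ∀ Θ, MapsTo (A Θ) closedUnitDisk (ball 0 1)
  contraction : ∀ Θ, ∀ z ∈ closedUnitDisk, ∀ w ∈ closedUnitDisk,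
    dist (A Θ z) (A Θ w) ≤ lam * dist z w
  embedding : IsSmoothEmbeddingOn (solidTorusModel k) (solidTorusModel k) (solenoidMap A)
    (solidTorus k)

/-- The leaf `e({Θ} × 𝔻)`, an element of the foliation `𝓕^s` of `e(𝕋^k × 𝔻)` by disks. -/
def stableLeaf {k : ℕ} {X : Type*} (e : Torus k × ℂ → X) (Θ : Torus k) : Set X :=
  e '' ({Θ} ×ˢ closedUnitDisk)

/-- The projection `e(𝕋^k × 𝔻) → e(𝕋^k × {0})` along the leaves: `e(Θ, z) ↦ e(Θ, 0)`.
It is meaningful on `e(𝕋^k × 𝔻)` when `e` is injective on the solid torus. -/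
noncomputable def leafProjection {k : ℕ} {X : Type*} (e : Torus k × ℂ → X) (w : X) : X :=
  e ((Function.invFunOn e (solidTorus k) w).1, 0)

/-! The solid torus is placed in ℝ^k × ℂ, hence in the ball, by iterated spinning (`spinEmb`): for
each circle factor a half-space is rotated about its boundary. Call a self-embedding φ of the solid
torus admissible (`IsIsotopicToId`) if `spinEmb k` is isotopic to `spinEmb k ∘ φ`. Admissible maps
are closed under composition, and under product with a circle, because spinning an isotopy gives an
isotopy. It therefore suffices to double one circle at a time. The case k = 1 is multiplied by
identities, moved to other coordinates by exchanging circles, and composed. Exchanging two circles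
reverses orientation, so it is paired with conjugation of the disk; `isIsotopicToId_swapConj`
realises the isotopy by explicit rotations.

For k = 1 the isotopy takes place in the space of rays of ℂ², that is, in the 3-sphere. The core
(θ², cθ) of the doubled torus is a graph over its second coordinate, hence unknotted. The family
`twistMap` thickens this observation: up to positive scaling it contains `doubling c`
(`doubling_eq_smul_twistMap`), and at the other end it is a standard solid torus turned by a right
angle. Stereographic projection returns to ℝ³, and the only obstruction is the pole, which a
rotation by π/4 moves out of the way. The scale c is free, so the fibre contraction can be as strong
as desired.

All isotopies are built in vector spaces, through maps with smooth left inverses;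
`isSmoothEmbeddingOn_of_smoothEmbOn` transfers them to the manifold 𝕋^k × 𝔻. -/

/-! ### Embeddings with smooth left inverses, and their isotopies -/

section Isotopy

variable {V V' E E' : Type*}
  [NormedAddCommGroup V] [NormedSpace ℝ V] [NormedAddCommGroup V'] [NormedSpace ℝ V']
  [NormedAddCommGroup E] [NormedSpace ℝ E] [NormedAddCommGroup E'] [NormedSpace ℝ E']

/-- A map between normed spaces, smooth on the set `K`, with a left inverse that is smooth on the
image of `K`. -/
structure SmoothEmbOn (f : V → E) (K : Set V) : Prop where
  contDiffOn : ContDiffOn ℝ ∞ f K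
  exists_leftInvOn : ∃ L : E → V, ContDiffOn ℝ ∞ L (f '' K) ∧ LeftInvOn L f K

theorem SmoothEmbOn.of_leftInvOn {f : V → E} {K : Set V} {U : Set E} (L : E → V)
    (hf : ContDiffOn ℝ ∞ f K) (hU : MapsTo f K U) (hL : ContDiffOn ℝ ∞ L U)
    (h : LeftInvOn L f K) : SmoothEmbOn f K :=
  ⟨hf, L, hL.mono hU.image_subset, h⟩

theorem SmoothEmbOn.congr {f g : V → E} {K : Set V} (hf : SmoothEmbOn f K) (h : EqOn g f K) :
    SmoothEmbOn g K := by
  obtain ⟨L, hL, hLf⟩ := hf.exists_leftInvOn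
  refine ⟨hf.contDiffOn.congr h, L, ?_, fun x hx => ?_⟩
  · rwa [h.image_eq]
  · rw [h hx, hLf hx]

theorem SmoothEmbOn.comp {g : V' → E} {f : V → V'} {K : Set V} {K' : Set V'}
    (hg : SmoothEmbOn g K') (hf : SmoothEmbOn f K) (h : MapsTo f K K') :
    SmoothEmbOn (g ∘ f) K := by
  obtain ⟨L, hL, hLf⟩ := hf.exists_leftInvOn
  obtain ⟨M, hM, hMg⟩ := hg.exists_leftInvOn
  refine ⟨hg.contDiffOn.comp hf.contDiffOn h, L ∘ M, ?_, fun x hx => ?_⟩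
  · refine hL.comp (hM.mono ?_) ?_
    · rintro _ ⟨x, hx, rfl⟩
      exact ⟨f x, h hx, rfl⟩
    · rintro _ ⟨x, hx, rfl⟩
      exact ⟨x, hx, (hMg (h hx)).symm⟩
  · simp only [Function.comp_apply]
    rw [hMg (h hx), hLf hx]

theorem SmoothEmbOn.injOn {f : V → E} {K : Set V} (hf : SmoothEmbOn f K) : InjOn f K := by
  obtain ⟨L, -, hLf⟩ := hf.exists_leftInvOn
  exact hLf.injOn

theorem SmoothEmbOn.id (K : Set V) : SmoothEmbOn (fun x : V => x) K :=
  ⟨contDiffOn_id, fun x => x, contDiffOn_id, fun _ _ => rfl⟩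

theorem SmoothEmbOn.prodMap {f : V → E} {g : V' → E'} {K : Set V} {K' : Set V'}
    (hf : SmoothEmbOn f K) (hg : SmoothEmbOn g K') : SmoothEmbOn (Prod.map f g) (K ×ˢ K') := by
  obtain ⟨L, hL, hLf⟩ := hf.exists_leftInvOn
  obtain ⟨M, hM, hMg⟩ := hg.exists_leftInvOn
  refine ⟨hf.contDiffOn.prodMap hg.contDiffOn, Prod.map L M, ?_, ?_⟩
  · exact (hL.prodMap hM).mono (prodMap_image_prod f g K K').subset
  · rintro ⟨x, y⟩ ⟨hx, hy⟩
    exact Prod.ext (hLf hx) (hMg hy)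

theorem ContinuousLinearEquiv.smoothEmbOn (Φ : V ≃L[ℝ] E) (K : Set V) : SmoothEmbOn Φ K :=
  ⟨Φ.contDiff.contDiffOn, Φ.symm, Φ.symm.contDiff.contDiffOn, fun x _ => Φ.symm_apply_apply x⟩

/-- A smooth isotopy between two maps on a set `K`, parametrized by the real line and constant
outside of `[1/4, 3/4]`. -/
def IsotopicOn (f g : V → E) (K : Set V) : Prop :=
  ∃ F : ℝ → V → E, ContDiffOn ℝ ∞ (fun q : ℝ × V => F q.1 q.2) (univ ×ˢ K) ∧
    (∀ t, SmoothEmbOn (F t) K) ∧ (∀ t ≤ (1 / 4 : ℝ), EqOn (F t) f K) ∧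
    (∀ t, (3 / 4 : ℝ) ≤ t → EqOn (F t) g K)

/-- Reparametrizing time by a smooth step function makes any family over [0, 1] stationary near both
ends. -/
theorem IsotopicOn.of_family {f g : V → E} {K : Set V} (F : ℝ → V → E)
    (hF : ContDiffOn ℝ ∞ (fun q : ℝ × V => F q.1 q.2) (Icc 0 1 ×ˢ K))
    (hemb : ∀ t ∈ Icc (0 : ℝ) 1, SmoothEmbOn (F t) K) (h0 : EqOn (F 0) f K)
    (h1 : EqOn (F 1) g K) : IsotopicOn f g K := by
  have hmem (t : ℝ) : Real.smoothTransition t ∈ Icc (0 : ℝ) 1 :=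
    ⟨Real.smoothTransition.nonneg t, Real.smoothTransition.le_one t⟩
  -- The argument 2t - 1/2 reaches 0 at t = 1/4 and 1 at t = 3/4.
  refine ⟨fun t => F (Real.smoothTransition (2 * t - 1 / 2)), ?_, fun t => hemb _ (hmem _),
    fun t ht => ?_, fun t ht => ?_⟩
  · refine hF.comp (f := fun q : ℝ × V => (Real.smoothTransition (2 * q.1 - 1 / 2), q.2)) ?_ ?_
    · have : ContDiff ℝ ∞ (fun q : ℝ × V => (Real.smoothTransition (2 * q.1 - 1 / 2), q.2)) :=
        (Real.smoothTransition.contDiff.comp (by fun_prop)).prodMk contDiff_snd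
      exact this.contDiffOn
    · exact fun q hq => ⟨hmem _, hq.2⟩
  · beta_reduce
    rw [Real.smoothTransition.zero_of_nonpos (by linarith)]
    exact h0
  · beta_reduce
    rw [Real.smoothTransition.one_of_one_le (by linarith)]
    exact h1

theorem IsotopicOn.refl {f : V → E} {K : Set V} (hf : SmoothEmbOn f K) : IsotopicOn f f K :=
  ⟨fun _ => f, hf.contDiffOn.comp contDiffOn_snd fun _ hq => hq.2, fun _ => hf,
    fun _ _ _ _ => rfl, fun _ _ _ _ => rfl⟩

theorem IsotopicOn.symm {f g : V → E} {K : Set V} (h : IsotopicOn f g K) : IsotopicOn g f K := by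
  obtain ⟨F, hF, hemb, h0, h1⟩ := h
  refine ⟨fun t => F (1 - t), ?_, fun t => hemb _, fun t ht => h1 _ (by linarith),
    fun t ht => h0 _ (by linarith)⟩
  refine hF.comp (f := fun q : ℝ × V => (1 - q.1, q.2)) (by fun_prop) ?_
  exact fun q hq => ⟨mem_univ _, hq.2⟩

theorem IsotopicOn.congr {f g f' g' : V → E} {K : Set V} (h : IsotopicOn f g K)
    (hf : EqOn f f' K) (hg : EqOn g g' K) : IsotopicOn f' g' K := by
  obtain ⟨F, hF, hemb, h0, h1⟩ := h
  exact ⟨F, hF, hemb, fun t ht => (h0 t ht).trans hf, fun t ht => (h1 t ht).trans hg⟩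

theorem IsotopicOn.left {f g : V → E} {K : Set V} (h : IsotopicOn f g K) : SmoothEmbOn f K := by
  obtain ⟨F, hF, hemb, h0, h1⟩ := h
  exact (hemb 0).congr (h0 0 (by norm_num)).symm

theorem IsotopicOn.trans {f g h : V → E} {K : Set V} (hfg : IsotopicOn f g K)
    (hgh : IsotopicOn g h K) : IsotopicOn f h K := by
  obtain ⟨F, hF, hFe, hF0, hF1⟩ := hfg
  obtain ⟨G, hG, hGe, hG0, hG1⟩ := hgh
  -- The first isotopy has reached `g` at t = 5/12 and the second leaves it no earlier than t =
  -- 7/12, so the gluing at 1/2 happens while both are stationary.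
  refine ⟨fun t => if t ≤ 1 / 2 then F (3 * t - 1 / 2) else G (3 * t - 3 / 2), ?_, fun t => ?_,
    fun t ht => ?_, fun t ht => ?_⟩
  · have hF' : ContDiffOn ℝ ∞ (fun q : ℝ × V => F (3 * q.1 - 1 / 2) q.2) (univ ×ˢ K) :=
      hF.comp (f := fun q : ℝ × V => (3 * q.1 - 1 / 2, q.2)) (by fun_prop)
        fun q hq => ⟨mem_univ _, hq.2⟩
    have hG' : ContDiffOn ℝ ∞ (fun q : ℝ × V => G (3 * q.1 - 3 / 2) q.2) (univ ×ˢ K) :=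
      hG.comp (f := fun q : ℝ × V => (3 * q.1 - 3 / 2, q.2)) (by fun_prop)
        fun q hq => ⟨mem_univ _, hq.2⟩
    rintro ⟨t, x⟩ hq
    -- Any threshold strictly between 5/12 and 1/2 gives two overlapping open ranges of t, on each
    -- of which a single formula is valid.
    rcases le_or_gt t (11 / 24) with ht | ht
    · have hnhds : ∀ᶠ q : ℝ × V in 𝓝[univ ×ˢ K] (t, x), q.1 < 1 / 2 :=
        nhdsWithin_le_nhds ((continuous_fst.tendsto (t, x)).eventually
          (gt_mem_nhds (show t < 1 / 2 by linarith)))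
      refine (hF' _ hq).congr_of_eventuallyEq ?_ ?_
      · filter_upwards [hnhds] with q hq
        simp only [if_pos hq.le]
      · simp only [if_pos (show t ≤ 1 / 2 by linarith)]
    · have hnhds : ∀ᶠ q : ℝ × V in 𝓝[univ ×ˢ K] (t, x), 5 / 12 < q.1 :=
        nhdsWithin_le_nhds ((continuous_fst.tendsto (t, x)).eventually
          (lt_mem_nhds (show 5 / 12 < t by linarith)))
      have key : ∀ q ∈ (univ ×ˢ K : Set (ℝ × V)), 5 / 12 < q.1 →
          (if q.1 ≤ 1 / 2 then F (3 * q.1 - 1 / 2) else G (3 * q.1 - 3 / 2)) q.2 =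
            G (3 * q.1 - 3 / 2) q.2 := by
        intro q hq hlt
        split_ifs with hle
        · rw [hF1 _ (by linarith) hq.2, hG0 _ (by linarith) hq.2]
        · rfl
      refine (hG' _ hq).congr_of_eventuallyEq ?_ (key _ hq (by simp only; linarith))
      filter_upwards [hnhds, self_mem_nhdsWithin] with q hlt hq using key q hq hlt
  · dsimp only
    split_ifs
    · exact hFe _
    · exact hGe _
  · simp only [if_pos (show t ≤ 1 / 2 by linarith)]
    exact hF0 _ (by linarith)
  · simp only [if_neg (show ¬ t ≤ 1 / 2 by linarith)]
    exact hG1 _ (by linarith)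

theorem IsotopicOn.comp_right {f g : V' → E} {φ : V → V'} {K' : Set V'} {K : Set V}
    (h : IsotopicOn f g K') (hφ : SmoothEmbOn φ K) (hm : MapsTo φ K K') :
    IsotopicOn (f ∘ φ) (g ∘ φ) K := by
  obtain ⟨F, hF, hemb, h0, h1⟩ := h
  refine ⟨fun t => F t ∘ φ, ?_, fun t => (hemb t).comp hφ hm,
    fun t ht x hx => h0 t ht (hm hx), fun t ht x hx => h1 t ht (hm hx)⟩
  refine hF.comp (f := fun q : ℝ × V => (q.1, φ q.2)) ?_ fun q hq => ⟨mem_univ _, hm hq.2⟩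
  exact contDiffOn_fst.prodMk (hφ.contDiffOn.comp contDiffOn_snd fun q hq => hq.2)

/-- Products of an isotopy with the identity of a set `S`, followed by an embedding. -/
theorem IsotopicOn.comp_left_prod {f g : V → E} {K : Set V} {S : Set V'} {Φ : V' × E → E'}
    (h : IsotopicOn f g K) (hΦ : SmoothEmbOn Φ (S ×ˢ univ)) :
    IsotopicOn (fun p : V' × V => Φ (p.1, f p.2)) (fun p : V' × V => Φ (p.1, g p.2))
      (S ×ˢ K) := by
  obtain ⟨F, hF, hemb, h0, h1⟩ := h
  refine ⟨fun t p => Φ (p.1, F t p.2), ?_, fun t => ?_, fun t ht p hp => ?_, fun t ht p hp => ?_⟩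
  · refine hΦ.contDiffOn.comp (f := fun q : ℝ × (V' × V) => (q.2.1, F q.1 q.2.2)) ?_
      fun q hq => ⟨hq.2.1, mem_univ _⟩
    refine contDiffOn_snd.fst.prodMk (hF.comp (f := fun q : ℝ × (V' × V) => (q.1, q.2.2)) ?_ ?_)
    · fun_prop
    · exact fun q hq => ⟨mem_univ _, hq.2.2⟩
  · exact hΦ.comp ((SmoothEmbOn.id S).prodMap (hemb t)) fun p hp => ⟨hp.1, mem_univ _⟩
  · simp only [h0 t ht hp.2]
  · simp only [h1 t ht hp.2]

/-! ### Rotations as a source of isotopies -/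

/-- The rotation by the angle `a` generated by `J` with `J³ = -J`. -/
noncomputable def rotationBy (J : E →L[ℝ] E) (a : ℝ) (x : E) : E :=
  x + Real.sin a • J x + (1 - Real.cos a) • J (J x)

/-- The relation J³ = -J collapses the exponential series of aJ to `rotationBy J a`, so opposite
angles give inverse maps. -/
theorem rotationBy_neg_apply {J : E →L[ℝ] E} (hJ : ∀ x, J (J (J x)) = -J x) (a : ℝ) (x : E) :
    rotationBy J (-a) (rotationBy J a x) = x := by
  simp only [rotationBy, map_add, map_smul, hJ, map_neg, Real.sin_neg, Real.cos_neg]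
  have h := Real.sin_sq_add_cos_sq a
  have h2 : x + Real.sin a • J x + (1 - Real.cos a) • J (J x) +
      -Real.sin a • (J x + Real.sin a • J (J x) + (1 - Real.cos a) • -J x) +
      (1 - Real.cos a) • (J (J x) + Real.sin a • -J x + (1 - Real.cos a) • -J (J x)) =
      x + (1 - (Real.sin a ^ 2 + Real.cos a ^ 2)) • J (J x) := by module
  rw [h2, h]
  simp

theorem contDiff_rotationBy (J : E →L[ℝ] E) :
    ContDiff ℝ ∞ (fun q : ℝ × E => rotationBy J q.1 q.2) := by
  unfold rotationBy
  fun_prop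

theorem SmoothEmbOn.isotopicOn_rotationBy {f : V → E} {K : Set V} (hf : SmoothEmbOn f K)
    {J : E →L[ℝ] E} (hJ : ∀ x, J (J (J x)) = -J x) (a : ℝ) :
    IsotopicOn f (fun x => rotationBy J a (f x)) K := by
  have hs (b : ℝ) : ContDiff ℝ ∞ (rotationBy J b) :=
    (contDiff_rotationBy J).comp (contDiff_const.prodMk contDiff_id)
  refine IsotopicOn.of_family (fun t x => rotationBy J (t * a) (f x)) ?_ (fun t _ => ?_)
    (fun x _ => ?_) (fun x _ => ?_)
  · refine (contDiff_rotationBy J).comp_contDiffOn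
      (f := fun q : ℝ × V => (q.1 * a, f q.2)) ?_
    exact (by fun_prop : ContDiffOn ℝ ∞ (fun q : ℝ × V => q.1 * a) _).prodMk
      (hf.contDiffOn.comp contDiffOn_snd fun _ hq => hq.2)
  · exact (SmoothEmbOn.of_leftInvOn (K := univ) (U := univ) (rotationBy J (-(t * a)))
      (hs _).contDiffOn (mapsTo_univ _ _) (hs _).contDiffOn
      fun x _ => rotationBy_neg_apply hJ _ x).comp hf (mapsTo_univ _ _)
  · simp [rotationBy]
  · simp

end Isotopy

/-! ### The iterated spin embedding -/

/-- The solid torus as a subset of the vector space `ℂ^k × ℂ`. -/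
def solidTorusSet (k : ℕ) : Set ((Fin k → ℂ) × ℂ) := {p | (∀ i, ‖p.1 i‖ = 1) ∧ ‖p.2‖ ≤ 1}

/-- The diffeomorphism `x ↦ x + √(1 + x²)` from the line onto the half-line. -/
noncomputable def halfLineMap (x : ℝ) : ℝ := x + √(1 + x ^ 2)

theorem halfLineMap_pos (x : ℝ) : 0 < halfLineMap x := by
  have h : |x| < √(1 + x ^ 2) := by
    rw [← Real.sqrt_sq_eq_abs]
    exact Real.sqrt_lt_sqrt (sq_nonneg x) (by linarith)
  unfold halfLineMap
  linarith [neg_abs_le x]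

/-- The reciprocal of x + √(1 + x²) is √(1 + x²) - x, so half the difference is x. -/
theorem halfLineMap_inv (x : ℝ) : (halfLineMap x - (halfLineMap x)⁻¹) / 2 = x := by
  have h : (halfLineMap x)⁻¹ = √(1 + x ^ 2) - x := by
    refine inv_eq_of_mul_eq_one_right ?_
    unfold halfLineMap
    linear_combination Real.sq_sqrt (show 0 ≤ 1 + x ^ 2 by positivity)
  rw [h, halfLineMap]
  ring

theorem contDiff_halfLineMap : ContDiff ℝ ∞ halfLineMap := by
  unfold halfLineMap
  exact contDiff_id.add ((by fun_prop : ContDiff ℝ ∞ fun x : ℝ => 1 + x ^ 2).sqrt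
    fun x => by positivity)

theorem contDiff_finCons {V : Type*} [NormedAddCommGroup V] [NormedSpace ℝ V] {F : Type*}
    [NormedAddCommGroup F] [NormedSpace ℝ F] {n : ℕ} {f : V → F} {g : V → Fin n → F}
    (hf : ContDiff ℝ ∞ f) (hg : ContDiff ℝ ∞ g) :
    ContDiff ℝ ∞ (fun x => (Fin.cons (f x) (g x) : Fin (n + 1) → F)) := by
  rw [contDiff_pi]
  intro i
  refine Fin.cases ?_ (fun j => ?_) i
  · simpa using hf
  · simpa using (contDiff_pi.1 hg) j

/-- Rotating the half-space `ℝ^n × ℝ × (0, ∞)` about its boundary. -/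
noncomputable def spin {n : ℕ} (p : ℂ × ((Fin n → ℝ) × ℂ)) : (Fin (n + 1) → ℝ) × ℂ :=
  (Fin.cons p.2.2.im p.2.1, (halfLineMap p.2.2.re : ℂ) * p.1)

theorem contDiffOn_norm_ne_zero {s : Set ℂ} (hs : ∀ z ∈ s, z ≠ 0) :
    ContDiffOn ℝ ∞ (fun z : ℂ => ‖z‖) s :=
  fun z hz => (contDiffAt_norm ℝ (hs z hz)).contDiffWithinAt

theorem contDiff_complexRe : ContDiff ℝ ∞ Complex.re := Complex.reCLM.contDiff
theorem contDiff_complexIm : ContDiff ℝ ∞ Complex.im := Complex.imCLM.contDiff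
theorem contDiff_complexOfReal : ContDiff ℝ ∞ Complex.ofReal := Complex.ofRealCLM.contDiff
theorem contDiff_complexConj : ContDiff ℝ ∞ (starRingEnd ℂ) :=
  Complex.conjCLE.contDiff

/-- Polar coordinates in the last factor: the phase returns the circle coordinate, the radius
returns Re z through the inverse of `halfLineMap`, and the new real coordinate is Im z. -/
theorem smoothEmbOn_spin (n : ℕ) : SmoothEmbOn (spin (n := n)) (sphere 0 1 ×ˢ univ) := by
  refine SmoothEmbOn.of_leftInvOn (U := {x | x.2 ≠ 0})
    (fun x => (‖x.2‖⁻¹ • x.2, (fun i => x.1 i.succ,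
      (((‖x.2‖ - ‖x.2‖⁻¹) / 2 : ℝ) : ℂ) + (x.1 0 : ℂ) * Complex.I))) ?_ ?_ ?_ ?_
  · refine ContDiff.contDiffOn ?_
    unfold spin
    refine (contDiff_finCons (contDiff_complexIm.comp (by fun_prop)) (by fun_prop)).prodMk ?_
    refine ContDiff.mul ?_ contDiff_fst
    exact contDiff_complexOfReal.comp (contDiff_halfLineMap.comp
      (contDiff_complexRe.comp (by fun_prop)))
  · rintro ⟨θ, q, z⟩ ⟨hθ, -⟩
    have h1 : θ ≠ 0 := ne_zero_of_mem_unit_sphere (⟨θ, hθ⟩ : sphere (0 : ℂ) 1)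
    have h2 := (halfLineMap_pos z.re).ne'
    simp [spin, h1, h2]
  · have hn : ContDiffOn ℝ ∞ (fun x : (Fin (n + 1) → ℝ) × ℂ => ‖x.2‖) {x | x.2 ≠ 0} :=
      (contDiffOn_norm_ne_zero (s := {z | z ≠ 0}) fun _ h => h).comp contDiffOn_snd
        fun _ h => h
    have hnz : ∀ x ∈ {x : (Fin (n + 1) → ℝ) × ℂ | x.2 ≠ 0}, ‖x.2‖ ≠ 0 := fun x hx =>
      norm_ne_zero_iff.2 hx
    refine ContDiffOn.prodMk ?_ (ContDiffOn.prodMk (by fun_prop) (ContDiffOn.add ?_ ?_))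
    · exact (hn.inv hnz).smul contDiffOn_snd
    · exact contDiff_complexOfReal.comp_contDiffOn ((hn.sub (hn.inv hnz)).div_const 2)
    · exact (contDiff_complexOfReal.comp (by fun_prop)).contDiffOn.mul contDiffOn_const
  · rintro ⟨θ, q, z⟩ ⟨hθ, -⟩
    have hθ1 : ‖θ‖ = 1 := by simpa using hθ
    have hp := halfLineMap_pos z.re
    have hp' : (halfLineMap z.re : ℂ) ≠ 0 := by exact_mod_cast hp.ne'
    have hn : ‖(halfLineMap z.re : ℂ) * θ‖ = halfLineMap z.re := by
      rw [norm_mul, hθ1, mul_one, Complex.norm_real, Real.norm_of_nonneg hp.le]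
    simp only [spin, hn, halfLineMap_inv, Fin.cons_succ, Fin.cons_zero, Complex.re_add_im]
    rw [Complex.real_smul, Complex.ofReal_inv, inv_mul_cancel_left₀ hp']

/-- Splitting off the first circle coordinate. -/
def splitFirst {k : ℕ} (p : (Fin (k + 1) → ℂ) × ℂ) : ℂ × ((Fin k → ℂ) × ℂ) :=
  (p.1 0, (fun i => p.1 i.succ, p.2))

/-- The inverse of `splitFirst`. -/
def consFirst {k : ℕ} (p : ℂ × ((Fin k → ℂ) × ℂ)) : (Fin (k + 1) → ℂ) × ℂ :=
  (Fin.cons p.1 p.2.1, p.2.2)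

theorem contDiff_splitFirst {k : ℕ} : ContDiff ℝ ∞ (splitFirst (k := k)) := by
  unfold splitFirst
  fun_prop

theorem contDiff_consFirst {k : ℕ} : ContDiff ℝ ∞ (consFirst (k := k)) :=
  (contDiff_finCons contDiff_fst contDiff_snd.fst).prodMk contDiff_snd.snd

theorem consFirst_splitFirst {k : ℕ} (p : (Fin (k + 1) → ℂ) × ℂ) :
    consFirst (splitFirst p) = p :=
  Prod.ext (Fin.cons_self_tail p.1) rfl

theorem splitFirst_consFirst {k : ℕ} (p : ℂ × ((Fin k → ℂ) × ℂ)) :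
    splitFirst (consFirst p) = p := by
  simp [splitFirst, consFirst]

theorem smoothEmbOn_splitFirst {k : ℕ} (K : Set ((Fin (k + 1) → ℂ) × ℂ)) :
    SmoothEmbOn splitFirst K :=
  .of_leftInvOn (U := univ) consFirst contDiff_splitFirst.contDiffOn (mapsTo_univ _ _)
    contDiff_consFirst.contDiffOn fun p _ => consFirst_splitFirst p

theorem smoothEmbOn_consFirst {k : ℕ} (K : Set (ℂ × ((Fin k → ℂ) × ℂ))) :
    SmoothEmbOn consFirst K :=
  .of_leftInvOn (U := univ) splitFirst contDiff_consFirst.contDiffOn (mapsTo_univ _ _)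
    contDiff_splitFirst.contDiffOn fun p _ => splitFirst_consFirst p

theorem mapsTo_splitFirst (k : ℕ) :
    MapsTo splitFirst (solidTorusSet (k + 1)) (sphere 0 1 ×ˢ solidTorusSet k) :=
  fun _ hp => ⟨by simpa [splitFirst] using hp.1 0, fun i => hp.1 i.succ, hp.2⟩

theorem mapsTo_consFirst (k : ℕ) :
    MapsTo consFirst (sphere 0 1 ×ˢ solidTorusSet k) (solidTorusSet (k + 1)) := by
  rintro ⟨θ, w, z⟩ ⟨hθ, hw, hz⟩
  exact ⟨fun i => Fin.cases (by simpa [consFirst] using hθ) hw i, hz⟩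

/-- The iterated spin embedding of `𝕋^k × ℂ` into `ℝ^k × ℂ`. -/
noncomputable def spinEmb : (k : ℕ) → (Fin k → ℂ) × ℂ → (Fin k → ℝ) × ℂ
  | 0, p => (0, p.2)
  | k + 1, p => spin ((splitFirst p).1, spinEmb k (splitFirst p).2)

theorem IsotopicOn.spin {V : Type*} [NormedAddCommGroup V] [NormedSpace ℝ V] {n : ℕ}
    {f g : V → (Fin n → ℝ) × ℂ} {K : Set V} (h : IsotopicOn f g K) :
    IsotopicOn (fun p : ℂ × V => _root_.spin (p.1, f p.2))
      (fun p : ℂ × V => _root_.spin (p.1, g p.2)) (sphere 0 1 ×ˢ K) :=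
  h.comp_left_prod (smoothEmbOn_spin n)

theorem IsotopicOn.spin_splitFirst {k n : ℕ} {f g : (Fin k → ℂ) × ℂ → (Fin n → ℝ) × ℂ}
    (h : IsotopicOn f g (solidTorusSet k)) :
    IsotopicOn (fun p => _root_.spin ((splitFirst p).1, f (splitFirst p).2))
      (fun p => _root_.spin ((splitFirst p).1, g (splitFirst p).2)) (solidTorusSet (k + 1)) :=
  h.spin.comp_right (smoothEmbOn_splitFirst _) (mapsTo_splitFirst k)

theorem smoothEmbOn_spinEmb (k : ℕ) : SmoothEmbOn (spinEmb k) (solidTorusSet k) := by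
  induction k with
  | zero =>
    exact .of_leftInvOn (U := univ) (fun x => (0, x.2))
      (contDiff_const.prodMk contDiff_snd).contDiffOn (mapsTo_univ _ _)
      (contDiff_const.prodMk contDiff_snd).contDiffOn
      fun p _ => Prod.ext (Subsingleton.elim _ _) rfl
  | succ k ih => exact (IsotopicOn.refl ih).spin_splitFirst.left

/-! ### Self-embeddings preserving the isotopy class of the spin embedding -/

/-- A self-embedding of the solid torus which does not change the isotopy class of `spinEmb`. -/
structure IsIsotopicToId {k : ℕ} (φ : (Fin k → ℂ) × ℂ → (Fin k → ℂ) × ℂ) : Prop where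
  mapsTo : MapsTo φ (solidTorusSet k) (solidTorusSet k)
  smoothEmbOn : SmoothEmbOn φ (solidTorusSet k)
  isotopicOn : IsotopicOn (spinEmb k) (spinEmb k ∘ φ) (solidTorusSet k)

theorem IsIsotopicToId.comp {k : ℕ} {φ ψ : (Fin k → ℂ) × ℂ → (Fin k → ℂ) × ℂ}
    (hφ : IsIsotopicToId φ) (hψ : IsIsotopicToId ψ) : IsIsotopicToId (φ ∘ ψ) where
  mapsTo := hφ.mapsTo.comp hψ.mapsTo
  smoothEmbOn := hφ.smoothEmbOn.comp hψ.smoothEmbOn hψ.mapsTo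
  isotopicOn := hψ.isotopicOn.trans (hφ.isotopicOn.comp_right hψ.smoothEmbOn hψ.mapsTo)

/-- The product of a self-map of the solid `k`-torus with the identity of the circle. -/
def circleProd {k : ℕ} (φ : (Fin k → ℂ) × ℂ → (Fin k → ℂ) × ℂ)
    (p : (Fin (k + 1) → ℂ) × ℂ) : (Fin (k + 1) → ℂ) × ℂ :=
  consFirst ((splitFirst p).1, φ (splitFirst p).2)

theorem IsIsotopicToId.circleProd {k : ℕ} {φ : (Fin k → ℂ) × ℂ → (Fin k → ℂ) × ℂ}
    (hφ : IsIsotopicToId φ) : IsIsotopicToId (circleProd φ) where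
  mapsTo p hp := mapsTo_consFirst k
    ⟨(mapsTo_splitFirst k hp).1, hφ.mapsTo (mapsTo_splitFirst k hp).2⟩
  smoothEmbOn := (smoothEmbOn_consFirst _).comp
    (((SmoothEmbOn.id _).prodMap hφ.smoothEmbOn).comp (smoothEmbOn_splitFirst _)
      (mapsTo_splitFirst k)) (mapsTo_univ _ _)
  isotopicOn := by
    refine hφ.isotopicOn.spin_splitFirst.congr (fun p _ => rfl) (fun p _ => ?_)
    simp only [Function.comp_apply, _root_.circleProd, spinEmb, splitFirst_consFirst]

/-- Complex conjugation of the second factor. -/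
noncomputable def conjSnd {α : Type*} (p : α × ℂ) : α × ℂ := (p.1, starRingEnd ℂ p.2)

theorem smoothEmbOn_conjSnd {V : Type*} [NormedAddCommGroup V] [NormedSpace ℝ V]
    (K : Set (V × ℂ)) : SmoothEmbOn conjSnd K :=
  have h : ContDiff ℝ ∞ (conjSnd : V × ℂ → V × ℂ) :=
    contDiff_fst.prodMk (contDiff_complexConj.comp contDiff_snd)
  .of_leftInvOn (U := univ) conjSnd h.contDiffOn (mapsTo_univ _ _) h.contDiffOn
    fun p _ => by simp [conjSnd]

theorem mapsTo_conjSnd (k : ℕ) : MapsTo conjSnd (solidTorusSet k) (solidTorusSet k) :=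
  fun p hp => ⟨fun _ => hp.1 _, by simpa [conjSnd] using hp.2⟩

/-- Exchanging the first two circle coordinates, and conjugating the disk factor. -/
noncomputable def swapConj {k : ℕ} (p : (Fin (k + 2) → ℂ) × ℂ) : (Fin (k + 2) → ℂ) × ℂ :=
  (p.1 ∘ Equiv.swap 0 1, starRingEnd ℂ p.2)

theorem swapConj_swapConj {k : ℕ} (p : (Fin (k + 2) → ℂ) × ℂ) : swapConj (swapConj p) = p := by
  refine Prod.ext (funext fun i => ?_) ?_ <;> simp [swapConj]

theorem mapsTo_swapConj (k : ℕ) :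
    MapsTo swapConj (solidTorusSet (k + 2)) (solidTorusSet (k + 2)) :=
  fun p hp => ⟨fun _ => hp.1 _, by simpa [swapConj] using hp.2⟩

theorem smoothEmbOn_swapConj (k : ℕ) : SmoothEmbOn swapConj (solidTorusSet (k + 2)) := by
  have h : ContDiff ℝ ∞ (swapConj (k := k)) := by
    refine ContDiff.prodMk ?_ (contDiff_complexConj.comp contDiff_snd)
    rw [contDiff_pi]
    intro i
    simp only [Function.comp_apply]
    fun_prop
  exact .of_leftInvOn (U := univ) swapConj h.contDiffOn (mapsTo_univ _ _) h.contDiffOn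
    fun p _ => swapConj_swapConj p

/-! ### Exchanging two circles by rotations of ℝ^k × ℂ -/

/-- The infinitesimal rotation in the plane of the first real coordinate and `Re (ζ z)`. -/
noncomputable def mixedRotation (k : ℕ) (ζ : ℂ) :
    ((Fin (k + 1) → ℝ) × ℂ) →L[ℝ] ((Fin (k + 1) → ℝ) × ℂ) :=
  LinearMap.toContinuousLinearMap
    { toFun := fun x => (Pi.single 0 (-(starRingEnd ℂ ζ * x.2).re), (x.1 0 : ℂ) * ζ)
      map_add' := fun x y => by
        refine Prod.ext ?_ ?_
        · simp only [Prod.snd_add, Prod.fst_add, ← Pi.single_add, mul_add, Complex.add_re, neg_add]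
        · simp only [Prod.snd_add, Prod.fst_add, Pi.add_apply]
          push_cast
          ring
      map_smul' := fun c x => by
        refine Prod.ext ?_ ?_
        · simp only [Prod.smul_snd, Prod.smul_fst, RingHom.id_apply, ← Pi.single_smul]
          simp only [mul_smul_comm, Complex.smul_re, smul_neg]
        · simp only [Prod.smul_snd, Prod.smul_fst, RingHom.id_apply, Pi.smul_apply,
            Complex.real_smul, smul_eq_mul]
          push_cast
          ring }

theorem mixedRotation_apply (k : ℕ) (ζ : ℂ) (x : (Fin (k + 1) → ℝ) × ℂ) :
    mixedRotation k ζ x =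
      (Pi.single 0 (-(starRingEnd ℂ ζ * x.2).re), (x.1 0 : ℂ) * ζ) := rfl

/-- For a unit ζ the generator is a quarter turn of one plane and vanishes on the orthogonal
complement. -/
theorem mixedRotation_cube (k : ℕ) {ζ : ℂ} (hζ : ‖ζ‖ = 1) (x : (Fin (k + 1) → ℝ) × ℂ) :
    mixedRotation k ζ (mixedRotation k ζ (mixedRotation k ζ x)) = -mixedRotation k ζ x := by
  have h : starRingEnd ℂ ζ * ζ = 1 := by
    rw [← Complex.normSq_eq_conj_mul_self, Complex.normSq_eq_norm_sq, hζ]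
    simp
  have h' (a : ℂ) : starRingEnd ℂ ζ * (a * ζ) = a := by linear_combination a * h
  simp only [mixedRotation_apply, Pi.single_eq_same, h', Complex.ofReal_re]
  refine Prod.ext ?_ ?_
  · simp only [Prod.fst_neg, ← Pi.single_neg]
  · simp

theorem rotationBy_mixedRotation_I_pi (k : ℕ) (x : (Fin (k + 1) → ℝ) × ℂ) :
    rotationBy (mixedRotation k Complex.I) Real.pi x =
      (Fin.cons (-x.1 0) (Fin.tail x.1), starRingEnd ℂ x.2) := by
  simp only [rotationBy, mixedRotation_apply]
  refine Prod.ext (funext fun i => ?_) ?_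
  · refine Fin.cases ?_ (fun j => ?_) i
    · simp
      ring
    · simp [Fin.tail]
  · refine Complex.ext ?_ ?_
    · simp
    · simp
      ring

theorem rotationBy_mixedRotation_one_pi_div_two (k : ℕ) (x : (Fin (k + 1) → ℝ) × ℂ) :
    rotationBy (mixedRotation k 1) (Real.pi / 2) x =
      (Fin.cons (-x.2.re) (Fin.tail x.1), ⟨x.1 0, x.2.im⟩) := by
  simp only [rotationBy, mixedRotation_apply]
  refine Prod.ext (funext fun i => ?_) ?_
  · refine Fin.cases ?_ (fun j => ?_) i
    · simp
    · simp [Fin.tail]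
  · refine Complex.ext ?_ ?_
    · simp
    · simp

/-- The infinitesimal rotation of the complex factor. -/
noncomputable def diskRotation (k : ℕ) : ((Fin k → ℝ) × ℂ) →L[ℝ] ((Fin k → ℝ) × ℂ) :=
  (0 : ((Fin k → ℝ) × ℂ) →L[ℝ] (Fin k → ℝ)).prod
    ((Complex.I • ContinuousLinearMap.id ℝ ℂ) ∘L ContinuousLinearMap.snd ℝ (Fin k → ℝ) ℂ)

theorem diskRotation_apply (k : ℕ) (x : (Fin k → ℝ) × ℂ) :
    diskRotation k x = (0, Complex.I * x.2) := rfl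

theorem diskRotation_cube (k : ℕ) (x : (Fin k → ℝ) × ℂ) :
    diskRotation k (diskRotation k (diskRotation k x)) = -diskRotation k x := by
  simp only [diskRotation_apply]
  refine Prod.ext (by simp) ?_
  simp only [Prod.snd_neg]
  linear_combination (Complex.I * x.2) * Complex.I_mul_I

/-- Conjugation can be moved through one spin at a time. Spinning turns a conjugation of z into a
sign change of the new real coordinate Im z; a half turn in the plane of that coordinate and the
imaginary axis of ℂ trades this sign for conjugation of the outer factor. -/
theorem spinEmb_comp_conjSnd_isotopicOn (k : ℕ) :
    IsotopicOn (spinEmb k ∘ conjSnd) (conjSnd ∘ spinEmb k) (solidTorusSet k) := by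
  induction k with
  | zero =>
    exact .congr (.refl ((smoothEmbOn_spinEmb 0).comp (smoothEmbOn_conjSnd _) (mapsTo_conjSnd 0)))
      (fun _ _ => rfl) (fun _ _ => rfl)
  | succ k ih =>
    refine (ih.spin_splitFirst.congr (f' := spinEmb (k + 1) ∘ conjSnd) (fun _ _ => rfl)
      (fun _ _ => rfl)).trans ?_
    refine (ih.spin_splitFirst.symm.left.isotopicOn_rotationBy
      (mixedRotation_cube k (ζ := Complex.I) (by simp)) Real.pi).congr (fun _ _ => rfl)
      fun p _ => ?_
    simp only [rotationBy_mixedRotation_I_pi]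
    simp [spinEmb, spin, conjSnd]

/-- The map z ↦ i z̄ interchanges Re z and Im z, which is the form in which conjugation enters the
exchange of two circles. -/
theorem spinEmb_comp_conjSnd_isotopicOn_mul_I (k : ℕ) :
    IsotopicOn (spinEmb k ∘ conjSnd)
      (fun p => ((spinEmb k p).1, Complex.I * starRingEnd ℂ (spinEmb k p).2))
      (solidTorusSet k) := by
  refine (spinEmb_comp_conjSnd_isotopicOn k).trans
    (((spinEmb_comp_conjSnd_isotopicOn k).symm.left.isotopicOn_rotationBy (diskRotation_cube k)
      (Real.pi / 2)).congr (fun _ _ => rfl) fun p _ => ?_)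
  simp only [rotationBy, diskRotation_apply, Function.comp_apply, conjSnd]
  refine Prod.ext (by simp) ?_
  simp only [Real.sin_pi_div_two, Real.cos_pi_div_two, Prod.snd_add, one_smul,
    sub_zero]
  linear_combination (starRingEnd ℂ (spinEmb k p).2) * Complex.I_mul_I

/-- An infinitesimal rotation of `ℂ²`, generating a rotation whose value at the angle `π` is
`(U, V) ↦ (-iV, iU)`, where `U` consists of the first two real coordinates. -/
noncomputable def exchangeRotation (k : ℕ) :
    ((Fin (k + 2) → ℝ) × ℂ) →L[ℝ] ((Fin (k + 2) → ℝ) × ℂ) :=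
  LinearMap.toContinuousLinearMap
    { toFun := fun x => (Fin.cons (-(x.1 1 + x.2.re) / 2) (Fin.cons ((x.1 0 - x.2.im) / 2) 0),
        ⟨(x.1 0 - x.2.im) / 2, (x.1 1 + x.2.re) / 2⟩)
      map_add' := fun x y => by
        refine Prod.ext (funext fun i => ?_) ?_
        · refine Fin.cases ?_ (fun j => Fin.cases ?_ (fun l => ?_) j) i
          · simp
            ring
          · simp
            ring
          · simp
        · refine Complex.ext ?_ ?_
          · simp
            ring
          · simp
            ring
      map_smul' := fun c x => by
        refine Prod.ext (funext fun i => ?_) ?_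
        · refine Fin.cases ?_ (fun j => Fin.cases ?_ (fun l => ?_) j) i
          · simp
            ring
          · simp
            ring
          · simp
        · refine Complex.ext ?_ ?_
          · simp
            ring
          · simp
            ring }

theorem exchangeRotation_apply (k : ℕ) (x : (Fin (k + 2) → ℝ) × ℂ) :
    exchangeRotation k x =
      (Fin.cons (-(x.1 1 + x.2.re) / 2) (Fin.cons ((x.1 0 - x.2.im) / 2) 0),
        ⟨(x.1 0 - x.2.im) / 2, (x.1 1 + x.2.re) / 2⟩) := rfl

/-- On ℂ² the generator is i times the orthogonal projection onto the complex line U = iV, so its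
square is minus that projection. -/
theorem exchangeRotation_cube (k : ℕ) (x : (Fin (k + 2) → ℝ) × ℂ) :
    exchangeRotation k (exchangeRotation k (exchangeRotation k x)) = -exchangeRotation k x := by
  simp only [exchangeRotation_apply, Fin.cons_zero, Fin.cons_one]
  refine Prod.ext (funext fun i => ?_) ?_
  · refine Fin.cases ?_ (fun j => Fin.cases ?_ (fun l => ?_) j) i
    · simp
      ring
    · simp
      ring
    · simp
  · refine Complex.ext ?_ ?_
    · simp
      ring
    · simp
      ring

theorem rotationBy_exchangeRotation_pi (k : ℕ) (a b : ℝ) (q : Fin k → ℝ) (w : ℂ) :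
    rotationBy (exchangeRotation k) Real.pi (Fin.cons a (Fin.cons b q), w) =
      (Fin.cons w.im (Fin.cons (-w.re) q), ⟨-b, a⟩) := by
  simp only [rotationBy, exchangeRotation_apply, Fin.cons_zero, Fin.cons_one]
  refine Prod.ext (funext fun i => ?_) ?_
  · refine Fin.cases ?_ (fun j => Fin.cases ?_ (fun l => ?_) j) i
    · simp
      ring
    · simp
      ring
    · simp
  · refine Complex.ext ?_ ?_
    · simp
      ring
    · simp
      ring

/-- Write h for `halfLineMap` and let z be the complex coordinate of the innermost `spinEmb k`. A
quarter turn inserted between the last two spins brings the embedding to the form U = -i h(Re z) θ₁,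
V = h(Im z) θ₀, symmetric in the two circles except that Re z and Im z trade places. Rotating (U, V)
to (-iV, iU) gives the same form with θ₀ and θ₁ exchanged and z replaced by i z̄, which is what
conjugating the disk produces. -/
theorem isIsotopicToId_swapConj (k : ℕ) : IsIsotopicToId (swapConj (k := k)) := by
  refine ⟨mapsTo_swapConj k, smoothEmbOn_swapConj k, ?_⟩
  have hone := mixedRotation_cube k (ζ := 1) (by simp)
  have h1 : IsotopicOn (spinEmb (k + 2)) _ (solidTorusSet (k + 2)) :=
    ((smoothEmbOn_spinEmb (k + 1)).isotopicOn_rotationBy hone (Real.pi / 2)).spin_splitFirst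
  have h2 := h1.symm.left.isotopicOn_rotationBy (exchangeRotation_cube k) Real.pi
  -- The other end of the isotopy: the same symmetric form, now started from the conjugated
  -- embedding.
  have h3 := (spinEmb_comp_conjSnd_isotopicOn_mul_I k).spin_splitFirst
  have h4 := (h3.trans (h3.symm.left.isotopicOn_rotationBy hone (Real.pi / 2))).spin_splitFirst
  -- Composing `swapConj` with `conjSnd` leaves the bare exchange of circles, since the conjugation
  -- is already contained in the isotopy `h4`.
  have hm := mapsTo_conjSnd (k + 2)
  have h5 := h4.comp_right ((smoothEmbOn_swapConj k).comp (smoothEmbOn_conjSnd _) hm)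
    ((mapsTo_swapConj k).comp hm)
  refine (h1.trans h2).trans (h5.symm.congr (fun p _ => ?_) (fun p _ => ?_))
  · simp only [Function.comp_apply, rotationBy_mixedRotation_one_pi_div_two, spin, spinEmb,
      splitFirst, swapConj, conjSnd, Complex.conj_conj, Equiv.swap_apply_left, Fin.succ_zero_eq_one,
      Equiv.swap_apply_right, Fin.tail_cons, Fin.cons_zero, rotationBy_exchangeRotation_pi]
    have hs (i : Fin k) : Equiv.swap (0 : Fin (k + 2)) 1 i.succ.succ = i.succ.succ :=
      Equiv.swap_apply_of_ne_of_ne (Fin.succ_ne_zero _) (by simp [Fin.ext_iff])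
    simp only [hs]
    simp [Complex.ext_iff]
  · simp only [Function.comp_apply, spinEmb, splitFirst, swapConj, conjSnd, Complex.conj_conj]

/-! ### Rays of ℂ² and stereographic projection -/

section Stereographic

/-- The squared norm of a vector of `ℂ²`. -/
noncomputable def pairNormSq (x : ℂ × ℂ) : ℝ := Complex.normSq x.1 + Complex.normSq x.2

theorem contDiff_normSq : ContDiff ℝ ∞ (fun z : ℂ => Complex.normSq z) := by
  simp only [Complex.normSq_apply]
  exact (contDiff_complexRe.mul contDiff_complexRe).add (contDiff_complexIm.mul contDiff_complexIm)

theorem contDiff_pairNormSq : ContDiff ℝ ∞ pairNormSq :=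
  (contDiff_normSq.comp contDiff_fst).add (contDiff_normSq.comp contDiff_snd)

/-- The complement of the ray `{0} × [0, ∞)` in `ℂ²`. -/
def offPole : Set (ℂ × ℂ) := {x | x.1 = 0 → x.2.im = 0 → x.2.re < 0}

theorem re_lt_sqrt_pairNormSq {x : ℂ × ℂ} (hx : x ∈ offPole) : x.2.re < √(pairNormSq x) := by
  by_cases h : x.1 = 0 ∧ x.2.im = 0
  · exact (hx h.1 h.2).trans_le (Real.sqrt_nonneg _)
  · refine Real.lt_sqrt_of_sq_lt ?_
    rw [pairNormSq, Complex.normSq_apply x.2]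
    rw [not_and_or] at h
    rcases h with h | h
    · have := Complex.normSq_pos.2 h
      nlinarith [mul_self_nonneg x.2.im]
    · have := mul_self_pos.2 h
      nlinarith [Complex.normSq_nonneg x.1]

theorem pairNormSq_pos {x : ℂ × ℂ} (hx : x ∈ offPole) : 0 < pairNormSq x := by
  by_contra! h
  rw [pairNormSq] at h
  have h1 : Complex.normSq x.1 = 0 := by
    linarith [Complex.normSq_nonneg x.1, Complex.normSq_nonneg x.2]
  have h2 : Complex.normSq x.2 = 0 := by
    linarith [Complex.normSq_nonneg x.1, Complex.normSq_nonneg x.2]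
  rw [Complex.normSq_eq_zero] at h1 h2
  have := hx h1 (by simp [h2])
  simp [h2] at this

/-- Stereographic projection of the rays of `ℂ²` from the ray `{0} × [0, ∞)`. -/
noncomputable def stereoProj (x : ℂ × ℂ) : (Fin 1 → ℝ) × ℂ :=
  (√(pairNormSq x) - x.2.re)⁻¹ • ((fun _ => x.2.im, x.1) : (Fin 1 → ℝ) × ℂ)

theorem contDiffOn_stereoProj : ContDiffOn ℝ ∞ stereoProj offPole := by
  have h : ContDiffOn ℝ ∞ (fun x : ℂ × ℂ => √(pairNormSq x) - x.2.re) offPole :=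
    (contDiff_pairNormSq.contDiffOn.sqrt fun x hx => (pairNormSq_pos hx).ne').sub
      (contDiff_complexRe.comp contDiff_snd).contDiffOn
  refine (h.inv fun x hx => (sub_pos.2 (re_lt_sqrt_pairNormSq hx)).ne').smul
    (ContDiff.contDiffOn (ContDiff.prodMk ?_ contDiff_fst))
  exact contDiff_pi.2 fun _ => contDiff_complexIm.comp contDiff_snd

theorem stereoProj_smul {c : ℝ} (hc : 0 < c) (x : ℂ × ℂ) : stereoProj (c • x) = stereoProj x := by
  have h : √(pairNormSq (c • x)) = c * √(pairNormSq x) := by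
    have : pairNormSq (c • x) = c ^ 2 * pairNormSq x := by
      simp [pairNormSq, Complex.normSq_apply]
      ring
    rw [this, Real.sqrt_mul (sq_nonneg c), Real.sqrt_sq hc.le]
  have h2 : √(pairNormSq (c • x)) - (c • x).2.re = c * (√(pairNormSq x) - x.2.re) := by
    rw [h]
    simp
    ring
  have h3 : ((fun _ => (c • x).2.im, (c • x).1) : (Fin 1 → ℝ) × ℂ) =
      c • ((fun _ => x.2.im, x.1) : (Fin 1 → ℝ) × ℂ) := by
    refine Prod.ext (funext fun i => ?_) ?_ <;> simp
  rw [stereoProj, h2, h3, smul_smul, mul_inv, mul_right_comm, inv_mul_cancel₀ hc.ne', one_mul,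
    stereoProj]

/-- The inverse of the stereographic projection, up to scale. -/
noncomputable def stereoInv (y : (Fin 1 → ℝ) × ℂ) : ℂ × ℂ :=
  (2 * y.2, ((Complex.normSq y.2 + y.1 0 ^ 2 - 1 : ℝ) : ℂ) + ((2 * y.1 0 : ℝ) : ℂ) * Complex.I)

theorem contDiff_stereoInv : ContDiff ℝ ∞ stereoInv := by
  refine ContDiff.prodMk (by fun_prop) (ContDiff.add ?_ (ContDiff.mul ?_ contDiff_const))
  · exact contDiff_complexOfReal.comp
      (((contDiff_normSq.comp contDiff_snd).add (by fun_prop)).sub contDiff_const)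
  · exact contDiff_complexOfReal.comp (by fun_prop)

/-- The ray is recovered with a positive factor, which is all that a left inverse on rays requires.
-/
theorem stereoInv_stereoProj {x : ℂ × ℂ} (hx : x ∈ offPole) :
    stereoInv (stereoProj x) = (2 * (√(pairNormSq x) - x.2.re)⁻¹) • x := by
  have h := sub_pos.2 (re_lt_sqrt_pairNormSq hx)
  have hs := Real.sq_sqrt (pairNormSq_pos hx).le
  set D := √(pairNormSq x) - x.2.re with hD
  have hn : √(pairNormSq x) = D + x.2.re := by rw [hD]; ring
  rw [hn] at hs
  have hD0 := h.ne'
  simp only [stereoProj, ← hD, stereoInv]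
  simp only [pairNormSq, Complex.normSq_apply] at hs
  refine Prod.ext ?_ (Complex.ext ?_ ?_)
  · simp
    ring
  · have hre (a b : ℝ) : ((a : ℂ) + (b : ℂ) * Complex.I).re = a := by simp
    rw [hre]
    simp [Complex.normSq_apply]
    field_simp
    linear_combination -hs
  · have him (a b : ℝ) : ((a : ℂ) + (b : ℂ) * Complex.I).im = b := by simp
    rw [him]
    simp
    ring

variable {V : Type*} [NormedAddCommGroup V] [NormedSpace ℝ V]

/-- A smooth map to `ℂ²` which induces an embedding into the space of rays. -/
structure RayEmbOn (f : V → ℂ × ℂ) (K : Set V) : Prop where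
  contDiffOn : ContDiffOn ℝ ∞ f K
  exists_leftInvOn : ∃ (L : ℂ × ℂ → V) (U : Set (ℂ × ℂ)), ContDiffOn ℝ ∞ L U ∧ ∀ x ∈ K,
    ∀ c : ℝ, 0 < c → c • f x ∈ U ∧ L (c • f x) = x

theorem RayEmbOn.rescale {f g : V → ℂ × ℂ} {K : Set V} (hf : RayEmbOn f K)
    (hg : ContDiffOn ℝ ∞ g K) (l : V → ℝ) (hl : ∀ x ∈ K, 0 < l x) (h : ∀ x ∈ K, g x = l x • f x) :
    RayEmbOn g K := by
  obtain ⟨L, U, hL, hLf⟩ := hf.exists_leftInvOn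
  refine ⟨hg, L, U, hL, fun x hx c hc => ?_⟩
  rw [h x hx, smul_smul]
  exact hLf x hx _ (mul_pos hc (hl x hx))

theorem RayEmbOn.smoothEmbOn {f : V → ℂ × ℂ} {K : Set V} (hf : RayEmbOn f K) :
    SmoothEmbOn f K := by
  obtain ⟨L, U, hL, hLf⟩ := hf.exists_leftInvOn
  refine .of_leftInvOn (U := U) L hf.contDiffOn (fun x hx => ?_) hL fun x hx => ?_
  · simpa using (hLf x hx 1 one_pos).1
  · simpa using (hLf x hx 1 one_pos).2

/-- The left inverse of `f` on rays tolerates the positive factor left by `stereoInv`, so no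
normalization to the sphere is needed. -/
theorem RayEmbOn.stereoProj_comp {f : V → ℂ × ℂ} {K : Set V} (hf : RayEmbOn f K)
    (h : MapsTo f K offPole) : SmoothEmbOn (stereoProj ∘ f) K := by
  obtain ⟨L, U, hL, hLf⟩ := hf.exists_leftInvOn
  have hpos : ∀ x ∈ K, 0 < 2 * (√(pairNormSq (f x)) - (f x).2.re)⁻¹ := fun x hx =>
    mul_pos two_pos (inv_pos.2 (sub_pos.2 (re_lt_sqrt_pairNormSq (h hx))))
  refine .of_leftInvOn (U := stereoInv ⁻¹' U) (L ∘ stereoInv)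
    (contDiffOn_stereoProj.comp hf.contDiffOn h) (fun x hx => ?_)
    (hL.comp contDiff_stereoInv.contDiffOn fun _ hy => hy) fun x hx => ?_
  · simp only [mem_preimage, Function.comp_apply]
    rw [stereoInv_stereoProj (h hx)]
    exact (hLf x hx _ (hpos x hx)).1
  · simp only [Function.comp_apply]
    rw [stereoInv_stereoProj (h hx)]
    exact (hLf x hx _ (hpos x hx)).2

theorem isotopicOn_stereoProj_of_family {K : Set V} (F : ℝ → V → ℂ × ℂ)
    (hF : ContDiffOn ℝ ∞ (fun q : ℝ × V => F q.1 q.2) (Icc 0 1 ×ˢ K))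
    (hemb : ∀ t ∈ Icc (0 : ℝ) 1, RayEmbOn (F t) K)
    (hoff : ∀ t ∈ Icc (0 : ℝ) 1, MapsTo (F t) K offPole) :
    IsotopicOn (stereoProj ∘ F 0) (stereoProj ∘ F 1) K :=
  .of_family (fun t => stereoProj ∘ F t)
    (contDiffOn_stereoProj.comp hF fun q hq => hoff q.1 hq.1 hq.2)
    (fun t ht => (hemb t ht).stereoProj_comp (hoff t ht)) (fun _ _ => rfl) fun _ _ => rfl

/-- The real rotation of `ℂ²` by the angle `t`. -/
noncomputable def pairRotation (t : ℝ) (x : ℂ × ℂ) : ℂ × ℂ :=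
  (Real.cos t • x.1 + Real.sin t • x.2, Real.cos t • x.2 - Real.sin t • x.1)

theorem contDiff_pairRotation : ContDiff ℝ ∞ (fun q : ℝ × (ℂ × ℂ) => pairRotation q.1 q.2) := by
  unfold pairRotation
  fun_prop

theorem contDiff_pairRotation_apply (t : ℝ) : ContDiff ℝ ∞ (pairRotation t) := by
  unfold pairRotation
  fun_prop

theorem pairRotation_smul (t c : ℝ) (x : ℂ × ℂ) :
    pairRotation t (c • x) = c • pairRotation t x := by
  simp only [pairRotation, Prod.smul_fst, Prod.smul_snd, Prod.smul_mk, smul_add, smul_sub,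
    smul_comm c]

theorem pairRotation_neg_pairRotation (t : ℝ) (x : ℂ × ℂ) :
    pairRotation (-t) (pairRotation t x) = x := by
  have h : (Real.sin t : ℂ) ^ 2 + (Real.cos t : ℂ) ^ 2 = 1 := by
    exact_mod_cast Real.sin_sq_add_cos_sq t
  simp only [pairRotation, Real.cos_neg, Real.sin_neg, Complex.real_smul, Complex.ofReal_neg]
  refine Prod.ext ?_ ?_
  · linear_combination x.1 * h
  · linear_combination x.2 * h

theorem RayEmbOn.pairRotation {f : V → ℂ × ℂ} {K : Set V} (hf : RayEmbOn f K) (t : ℝ) :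
    RayEmbOn (fun x => pairRotation t (f x)) K := by
  obtain ⟨L, U, hL, hLf⟩ := hf.exists_leftInvOn
  refine ⟨(contDiff_pairRotation_apply t).comp_contDiffOn hf.contDiffOn,
    L ∘ _root_.pairRotation (-t), _root_.pairRotation (-t) ⁻¹' U,
    hL.comp (contDiff_pairRotation_apply _).contDiffOn fun _ h => h, fun x hx c hc => ?_⟩
  have := hLf x hx c hc
  simp only [mem_preimage, Function.comp_apply, pairRotation_smul, pairRotation_neg_pairRotation]
  exact this

/-- For angles up to π/4 the sine does not exceed the cosine, so the dominant first coordinate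
cannot be cancelled and the image stays off the pole. -/
theorem RayEmbOn.isotopicOn_pairRotation {f : V → ℂ × ℂ} {K : Set V} (hf : RayEmbOn f K)
    (h : ∀ x ∈ K, ‖(f x).2‖ < ‖(f x).1‖) :
    IsotopicOn (stereoProj ∘ f) (fun x => stereoProj (_root_.pairRotation (Real.pi / 4) (f x)))
      K := by
  refine (isotopicOn_stereoProj_of_family
    (fun t x => _root_.pairRotation (t * (Real.pi / 4)) (f x)) ?_
    (fun t _ => hf.pairRotation _) fun t ht x hx h0 _ => ?_).congr (fun x _ => ?_) (fun x _ => ?_)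
  · refine contDiff_pairRotation.comp_contDiffOn
      (f := fun q : ℝ × V => (q.1 * (Real.pi / 4), f q.2)) (ContDiffOn.prodMk (by fun_prop) ?_)
    exact hf.contDiffOn.comp contDiffOn_snd fun _ hq => hq.2
  · exfalso
    have hpi := Real.pi_pos
    set a := t * (Real.pi / 4) with ha
    have ha0 : 0 ≤ a := by have := ht.1; positivity
    have ha1 : a ≤ Real.pi / 4 := by
      rw [ha]
      exact mul_le_of_le_one_left (by positivity) ht.2
    have hs : 0 ≤ Real.sin a := Real.sin_nonneg_of_nonneg_of_le_pi ha0 (by linarith)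
    have hc : 0 < Real.cos a := Real.cos_pos_of_mem_Ioo ⟨by linarith, by linarith⟩
    have hsc : Real.sin a ≤ Real.cos a := by
      have h1 : Real.sin a ≤ Real.sin (Real.pi / 4) :=
        Real.sin_le_sin_of_le_of_le_pi_div_two (by linarith) (by linarith) ha1
      have h2 : Real.cos (Real.pi / 4) ≤ Real.cos a :=
        Real.cos_le_cos_of_nonneg_of_le_pi ha0 (by linarith) ha1
      rw [Real.sin_pi_div_four] at h1
      rw [Real.cos_pi_div_four] at h2
      exact h1.trans h2
    have h1 : ‖Real.cos a • (f x).1‖ = ‖Real.sin a • (f x).2‖ := by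
      simp only [_root_.pairRotation] at h0
      rw [eq_neg_of_add_eq_zero_left h0, norm_neg]
    rw [norm_smul, norm_smul, Real.norm_of_nonneg hs, Real.norm_of_nonneg hc.le] at h1
    have h2 := h x hx
    nlinarith [norm_nonneg (f x).2]
  · simp [_root_.pairRotation]
  · simp

/-- After the rotation by π/4 the ray to be avoided is the one through (-1, 1). -/
theorem pairRotation_pi_div_four_mem_offPole {x : ℂ × ℂ}
    (h : x.1 = -x.2 → x.2.im = 0 → x.2.re < 0) :
    pairRotation (Real.pi / 4) x ∈ offPole := by
  have h2 : (0 : ℝ) < √2 / 2 := by positivity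
  simp only [offPole, mem_ofPred_eq, pairRotation, Real.sin_pi_div_four, Real.cos_pi_div_four]
  intro h0 h1
  rw [← smul_add, smul_eq_zero, or_iff_right h2.ne'] at h0
  have h3 := eq_neg_of_add_eq_zero_left h0
  rw [h3] at h1 ⊢
  simp only [smul_neg, sub_neg_eq_add, Complex.add_im, Complex.add_re, Complex.smul_im,
    Complex.smul_re, smul_eq_mul] at h1 ⊢
  have h4 : √2 / 2 * x.2.im = 0 := by linarith
  have := h h3 ((mul_eq_zero.1 h4).resolve_left h2.ne')
  nlinarith

end Stereographic

/-! ### The doubling map inside the twist family -/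

/-- The solid torus `𝕊¹ × 𝔻` in `ℂ²`. -/
def circleDisk : Set (ℂ × ℂ) := sphere 0 1 ×ˢ closedBall 0 1

theorem norm_fst_of_mem_circleDisk {p : ℂ × ℂ} (hp : p ∈ circleDisk) : ‖p.1‖ = 1 := by
  simpa using hp.1

theorem norm_snd_of_mem_circleDisk {p : ℂ × ℂ} (hp : p ∈ circleDisk) : ‖p.2‖ ≤ 1 := by
  simpa using hp.2

theorem conj_mul_self_of_norm_eq_one {z : ℂ} (hz : ‖z‖ = 1) : starRingEnd ℂ z * z = 1 := by
  rw [← Complex.normSq_eq_conj_mul_self, Complex.normSq_eq_norm_sq, hz]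
  simp

/-- The phase of the principal square root of `m`, for `m` in the right half-plane. -/
noncomputable def unitSqrt (m : ℂ) : ℂ := ‖m + (‖m‖ : ℂ)‖⁻¹ • (m + (‖m‖ : ℂ))

theorem add_norm_ne_zero {m : ℂ} (hm : 0 < m.re) : m + (‖m‖ : ℂ) ≠ 0 := by
  intro h
  have := congrArg Complex.re h
  simp at this
  linarith [norm_nonneg m]

theorem norm_unitSqrt {m : ℂ} (hm : 0 < m.re) : ‖unitSqrt m‖ = 1 := by
  rw [unitSqrt, norm_smul, norm_inv, norm_norm,
    inv_mul_cancel₀ (norm_ne_zero_iff.2 (add_norm_ne_zero hm))]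

theorem unitSqrt_one : unitSqrt 1 = 1 := by
  norm_num [unitSqrt]

/-- The square of the phase is m/‖m‖, and m m̄ = ‖m‖². -/
theorem unitSqrt_sq_mul_conj {m : ℂ} (hm : 0 < m.re) :
    unitSqrt m ^ 2 * starRingEnd ℂ m = (‖m‖ : ℂ) := by
  have h0 := add_norm_ne_zero hm
  have h1 : (‖m + (‖m‖ : ℂ)‖ : ℂ) ^ 2 = (m + (‖m‖ : ℂ)) * (starRingEnd ℂ m + (‖m‖ : ℂ)) := by
    rw [← Complex.mul_conj']
    simp
  have h2 : (‖m + (‖m‖ : ℂ)‖ : ℂ) ≠ 0 := by exact_mod_cast norm_ne_zero_iff.2 h0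
  have h3 : (‖m‖ : ℂ) ^ 2 = m * starRingEnd ℂ m := (Complex.mul_conj' m).symm
  rw [unitSqrt, Complex.real_smul, Complex.ofReal_inv, mul_pow, inv_pow]
  rw [mul_assoc, inv_mul_eq_iff_eq_mul₀ (pow_ne_zero 2 h2), h1]
  linear_combination -(m + (‖m‖ : ℂ)) * h3

theorem contDiffOn_norm_re_pos : ContDiffOn ℝ ∞ (fun m : ℂ => (‖m‖ : ℂ)) {m | 0 < m.re} := by
  refine contDiff_complexOfReal.comp_contDiffOn (contDiffOn_norm_ne_zero ?_)
  rintro z hz rfl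
  exact lt_irrefl (0 : ℝ) hz

theorem contDiffOn_unitSqrt : ContDiffOn ℝ ∞ unitSqrt {m | 0 < m.re} := by
  have h : ContDiffOn ℝ ∞ (fun m : ℂ => m + (‖m‖ : ℂ)) {m | 0 < m.re} :=
    contDiffOn_id.add contDiffOn_norm_re_pos
  have h2 : ContDiffOn ℝ ∞ (fun m : ℂ => ‖m + (‖m‖ : ℂ)‖) {m | 0 < m.re} :=
    (contDiffOn_norm_ne_zero (s := {z | z ≠ 0}) fun _ h => h).comp h fun m hm =>
      add_norm_ne_zero hm
  exact (h2.inv fun m hm => norm_ne_zero_iff.2 (add_norm_ne_zero hm)).smul h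

/-- The number `1 - δ v̄`, whose square root determines the phase in `twistMap`. -/
noncomputable def twistParam (δ : ℝ) (v : ℂ) : ℂ := 1 - (δ : ℂ) * starRingEnd ℂ v

theorem twistParam_re_pos {δ : ℝ} {v : ℂ} (hδ : |δ| < 1) (hv : ‖v‖ ≤ 1) :
    0 < (twistParam δ v).re := by
  have h : |δ * v.re| < 1 := by
    rw [abs_mul]
    have := (Complex.abs_re_le_norm v).trans hv
    nlinarith [abs_nonneg δ, abs_nonneg v.re]
  simp only [twistParam, Complex.sub_re, Complex.one_re, Complex.re_ofReal_mul, Complex.conj_re]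
  linarith [(abs_lt.1 h).2]

theorem contDiff_twistParam : ContDiff ℝ ∞ (fun q : ℝ × ℂ => twistParam q.1 q.2) := by
  unfold twistParam
  exact contDiff_const.sub ((contDiff_complexOfReal.comp contDiff_fst).mul
    (contDiff_complexConj.comp contDiff_snd))

/-- The disk coordinate `z θ⁻²`, for `θ` in the unit circle. -/
noncomputable def untwist (p : ℂ × ℂ) : ℂ := p.2 * starRingEnd ℂ p.1 ^ 2

theorem contDiff_untwist : ContDiff ℝ ∞ untwist :=
  contDiff_snd.mul ((contDiff_complexConj.comp contDiff_fst).pow 2)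

theorem norm_untwist_le {p : ℂ × ℂ} (hp : p ∈ circleDisk) : ‖untwist p‖ ≤ 1 := by
  rw [untwist, norm_mul, norm_pow, RCLike.norm_conj, norm_fst_of_mem_circleDisk hp]
  simpa using norm_snd_of_mem_circleDisk hp

theorem sq_mul_untwist {p : ℂ × ℂ} (hp : p ∈ circleDisk) : p.1 ^ 2 * untwist p = p.2 := by
  have h := conj_mul_self_of_norm_eq_one (norm_fst_of_mem_circleDisk hp)
  rw [untwist]
  linear_combination p.2 * (starRingEnd ℂ p.1 * p.1 + 1) * h

/-- The phase of the second coordinate of `twistMap`. -/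
noncomputable def twistPhase (δ : ℝ) (p : ℂ × ℂ) : ℂ :=
  p.1 * unitSqrt (twistParam δ (untwist p))

/-- A family of maps `𝕊¹ × 𝔻 → ℂ²`, containing both a rescaling of the doubling map
`doubling` and a standard embedding. -/
noncomputable def twistMap (a τ δ : ℝ) (p : ℂ × ℂ) : ℂ × ℂ :=
  (twistPhase δ p ^ 2 * ((a : ℂ) - (τ : ℂ) * untwist p), twistPhase δ p)

theorem norm_twistPhase {δ : ℝ} (hδ : |δ| < 1) {p : ℂ × ℂ} (hp : p ∈ circleDisk) :
    ‖twistPhase δ p‖ = 1 := by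
  rw [twistPhase, norm_mul, norm_fst_of_mem_circleDisk hp, one_mul,
    norm_unitSqrt (twistParam_re_pos hδ (norm_untwist_le hp))]

theorem contDiffOn_twistPhase : ContDiffOn ℝ ∞ (fun q : ℝ × (ℂ × ℂ) => twistPhase q.1 q.2)
    ({δ | |δ| < 1} ×ˢ circleDisk) := by
  refine contDiffOn_snd.fst.mul (contDiffOn_unitSqrt.comp
    (f := fun q : ℝ × (ℂ × ℂ) => twistParam q.1 (untwist q.2)) ?_ ?_)
  · exact (contDiff_twistParam.comp
      (contDiff_fst.prodMk (contDiff_untwist.comp contDiff_snd))).contDiffOn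
  · exact fun q hq => twistParam_re_pos hq.1 (norm_untwist_le hq.2)

/-- The value of `untwist p` in terms of `twistMap a τ δ p`, up to scale. -/
noncomputable def twistInv (a τ : ℝ) (y : ℂ × ℂ) : ℂ :=
  τ⁻¹ • ((a : ℂ) - y.1 * (‖y.2‖ : ℂ) * (y.2 ^ 2)⁻¹)

theorem contDiffOn_norm_snd :
    ContDiffOn ℝ ∞ (fun y : ℂ × ℂ => ‖y.2‖) {y : ℂ × ℂ | y.2 ≠ 0} :=
  (contDiffOn_norm_ne_zero (s := {z | z ≠ 0}) fun _ h => h).comp contDiffOn_snd fun _ h => h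

theorem contDiffOn_twistInv (a τ : ℝ) :
    ContDiffOn ℝ ∞ (twistInv a τ) {y : ℂ × ℂ | y.2 ≠ 0} := by
  have h : ContDiffOn ℝ ∞ (fun y : ℂ × ℂ => (y.2 ^ 2)⁻¹) {y : ℂ × ℂ | y.2 ≠ 0} :=
    ContDiffOn.inv (by fun_prop) fun y hy => pow_ne_zero 2 hy
  exact (contDiffOn_const.sub ((contDiffOn_fst.mul
    (contDiff_complexOfReal.comp_contDiffOn contDiffOn_norm_snd)).mul h)).const_smul τ⁻¹

/-- The second coordinate of `twistMap` has modulus one, so it reveals both the scale c and the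
phase; dividing them out of the first coordinate leaves a - τv. -/
theorem twistInv_smul_twistMap {a τ δ : ℝ} (hτ : 0 < τ) (hδ : |δ| < 1) {p : ℂ × ℂ}
    (hp : p ∈ circleDisk) {c : ℝ} (hc : 0 < c) :
    twistInv a τ (c • twistMap a τ δ p) = untwist p := by
  have h1 := norm_twistPhase hδ hp
  have h2 : twistPhase δ p ≠ 0 := by
    rw [← norm_ne_zero_iff, h1]
    exact one_ne_zero
  have hc' : (c : ℂ) ≠ 0 := by exact_mod_cast hc.ne'
  have hτ' : (τ : ℂ) ≠ 0 := by exact_mod_cast hτ.ne'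
  simp only [twistInv, twistMap, Prod.smul_mk, norm_smul, h1, mul_one, Real.norm_of_nonneg hc.le]
  simp only [Complex.real_smul, Complex.ofReal_inv]
  field_simp
  ring

theorem rayEmbOn_twistMap {a τ δ : ℝ} (hτ : 0 < τ) (hδ : |δ| < 1) :
    RayEmbOn (twistMap a τ δ) circleDisk := by
  have hph : ContDiffOn ℝ ∞ (twistPhase δ) circleDisk :=
    contDiffOn_twistPhase.comp (f := fun p : ℂ × ℂ => (δ, p))
      (contDiff_const.prodMk contDiff_id).contDiffOn fun p hp => ⟨hδ, hp⟩
  -- Once v is known, the square-root phase is known, and removing it from the phase of the second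
  -- coordinate gives θ.
  let θ : ℂ × ℂ → ℂ := fun y =>
    ‖y.2‖⁻¹ • y.2 * starRingEnd ℂ (unitSqrt (twistParam δ (twistInv a τ y)))
  refine ⟨ContDiffOn.prodMk ((hph.pow 2).mul ?_) hph, fun y => (θ y, θ y ^ 2 * twistInv a τ y),
    {y | y.2 ≠ 0} ∩ {y | 0 < (twistParam δ (twistInv a τ y)).re}, ?_, fun p hp c hc => ?_⟩
  · exact (contDiff_const.sub (contDiff_const.mul contDiff_untwist)).contDiffOn
  · have h1 : ContDiffOn ℝ ∞ (twistInv a τ)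
        ({y | y.2 ≠ 0} ∩ {y | 0 < (twistParam δ (twistInv a τ y)).re}) :=
      (contDiffOn_twistInv a τ).mono inter_subset_left
    have h2 : ContDiffOn ℝ ∞ θ
        ({y | y.2 ≠ 0} ∩ {y | 0 < (twistParam δ (twistInv a τ y)).re}) := by
      have h3 := ((contDiffOn_norm_snd.mono inter_subset_left).inv fun y hy =>
        norm_ne_zero_iff.2 hy.1).smul (contDiffOn_snd
          (s := {y : ℂ × ℂ | y.2 ≠ 0} ∩ {y | 0 < (twistParam δ (twistInv a τ y)).re}))
      refine h3.mul
        (contDiff_complexConj.comp_contDiffOn (contDiffOn_unitSqrt.comp ?_ fun y hy => hy.2))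
      exact contDiff_twistParam.comp_contDiffOn (contDiffOn_const.prodMk h1)
    exact h2.prodMk ((h2.pow 2).mul h1)
  · have hn := norm_twistPhase hδ hp
    have hre := twistParam_re_pos hδ (norm_untwist_le hp)
    have hv := twistInv_smul_twistMap (a := a) hτ hδ hp hc
    have hne : (c • twistMap a τ δ p).2 ≠ 0 := by
      rw [Prod.smul_snd, twistMap, ← norm_ne_zero_iff, norm_smul, hn, mul_one]
      exact norm_ne_zero_iff.2 hc.ne'
    refine ⟨⟨hne, by rwa [mem_ofPred_eq, hv]⟩, ?_⟩
    have hθ : θ (c • twistMap a τ δ p) = p.1 := by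
      have hu := conj_mul_self_of_norm_eq_one (norm_unitSqrt hre)
      have h3 : ‖(c • twistMap a τ δ p).2‖⁻¹ • (c • twistMap a τ δ p).2 = twistPhase δ p := by
        rw [Prod.smul_snd, twistMap, norm_smul, hn, mul_one, Real.norm_of_nonneg hc.le, smul_smul,
          inv_mul_cancel₀ hc.ne', one_smul]
      simp only [θ]
      rw [h3, hv, twistPhase]
      linear_combination p.1 * hu
    simp only [hθ, hv]
    exact Prod.ext rfl (sq_mul_untwist hp)

/-- The map `h` in the formula `(θ, z) ↦ (θ², c θ h(z θ⁻²))` for the doubling map. -/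
noncomputable def doublingFibre (v : ℂ) : ℂ :=
  ‖twistParam (1 / 2) v‖⁻¹ • unitSqrt (twistParam (1 / 2) v)

/-- The doubling map of the solid torus, with fibres scaled by `c`. -/
noncomputable def doubling (c : ℝ) (p : ℂ × ℂ) : ℂ × ℂ :=
  (p.1 ^ 2, c • (p.1 * doublingFibre (untwist p)))

theorem half_le_twistParam_re {v : ℂ} (hv : ‖v‖ ≤ 1) : 1 / 2 ≤ (twistParam (1 / 2) v).re := by
  simp only [twistParam, Complex.sub_re, Complex.one_re, Complex.re_ofReal_mul, Complex.conj_re]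
  linarith [(Complex.re_le_norm v).trans hv]

theorem half_le_norm_twistParam {v : ℂ} (hv : ‖v‖ ≤ 1) : 1 / 2 ≤ ‖twistParam (1 / 2) v‖ :=
  (half_le_twistParam_re hv).trans (Complex.re_le_norm _)

theorem norm_doublingFibre_le {v : ℂ} (hv : ‖v‖ ≤ 1) : ‖doublingFibre v‖ ≤ 2 := by
  have h := half_le_norm_twistParam hv
  rw [doublingFibre, norm_smul, norm_unitSqrt (by linarith [half_le_twistParam_re hv]), mul_one,
    norm_inv, norm_norm]
  exact inv_le_of_inv_le₀ two_pos (by simpa using h)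

theorem contDiffOn_doublingFibre : ContDiffOn ℝ ∞ doublingFibre (closedBall 0 1) := by
  have h : ContDiff ℝ ∞ (twistParam (1 / 2)) :=
    contDiff_twistParam.comp (contDiff_const.prodMk contDiff_id)
  have hre : MapsTo (twistParam (1 / 2)) (closedBall 0 1) {m | 0 < m.re} := fun v hv => by
    have := half_le_twistParam_re (v := v) (by simpa using hv)
    rw [mem_ofPred_eq]
    linarith
  have hz : MapsTo (twistParam (1 / 2)) (closedBall 0 1) {z | z ≠ 0} := by
    intro v hv h0
    have := hre hv
    rw [h0] at this
    exact lt_irrefl (0 : ℝ) this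
  refine ContDiffOn.smul (ContDiffOn.inv ?_ fun v hv => norm_ne_zero_iff.2 (hz hv))
    (contDiffOn_unitSqrt.comp h.contDiffOn hre)
  exact (contDiffOn_norm_ne_zero (s := {z | z ≠ 0}) fun _ h => h).comp h.contDiffOn hz

/-- Smoothness on a compact convex set gives some Lipschitz constant; the fibre scale c absorbs it
later. -/
theorem exists_lipschitzOnWith_doublingFibre :
    ∃ C : NNReal, LipschitzOnWith C doublingFibre (closedBall 0 1) := by
  refine LocallyLipschitzOn.exists_lipschitzOnWith_of_compact (isCompact_closedBall 0 1) ?_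
  intro x hx
  exact ((contDiffOn_doublingFibre x hx).of_le (by simp)).exists_lipschitzOnWith
    (convex_closedBall 0 1)

/-- With m = 1 - v̄/2 and w = θ `unitSqrt m`, one has w²(1 - v/2) = θ²‖m‖. Hence (w²(1 - v/2)/c, w)
lies on the ray of (θ², cw/‖m‖); `doublingFibre` is designed for this identity. -/
theorem doubling_eq_smul_twistMap {c : ℝ} (hc : 0 < c) {p : ℂ × ℂ} (hp : p ∈ circleDisk) :
    doubling c p = (c * ‖twistParam (1 / 2) (untwist p)‖⁻¹) •
      twistMap c⁻¹ (c⁻¹ * (1 / 2)) (1 / 2) p := by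
  have hre := half_le_twistParam_re (norm_untwist_le hp)
  have h := unitSqrt_sq_mul_conj (m := twistParam (1 / 2) (untwist p)) (by linarith)
  have hn : (‖twistParam (1 / 2) (untwist p)‖ : ℂ) ≠ 0 := by
    have := half_le_norm_twistParam (norm_untwist_le hp)
    exact_mod_cast (show ‖twistParam (1 / 2) (untwist p)‖ ≠ 0 by linarith)
  have hc' : (c : ℂ) ≠ 0 := by exact_mod_cast hc.ne'
  have hconj : starRingEnd ℂ (twistParam (1 / 2) (untwist p)) = 1 - (1 / 2) * untwist p := by
    simp [twistParam, Complex.conj_ofNat]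
  rw [hconj] at h
  simp only [doubling, twistMap, doublingFibre, twistPhase, Complex.real_smul, Prod.smul_mk]
  set m := twistParam (1 / 2) (untwist p)
  refine Prod.ext ?_ ?_
  · push_cast
    field_simp
    linear_combination (-2 * p.1 ^ 2) * h
  · push_cast
    field_simp

theorem contDiffOn_doubling (c : ℝ) : ContDiffOn ℝ ∞ (doubling c) circleDisk := by
  refine ContDiffOn.prodMk (by fun_prop) ((contDiffOn_fst.mul
    (contDiffOn_doublingFibre.comp contDiff_untwist.contDiffOn fun p hp => ?_)).const_smul c)
  simpa using norm_untwist_le hp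

theorem rayEmbOn_doubling {c : ℝ} (hc : 0 < c) : RayEmbOn (doubling c) circleDisk := by
  refine (rayEmbOn_twistMap (a := c⁻¹) (τ := c⁻¹ * (1 / 2)) (δ := 1 / 2) (by positivity)
    (by norm_num [abs_of_pos])).rescale (contDiffOn_doubling c)
    (fun p => c * ‖twistParam (1 / 2) (untwist p)‖⁻¹) (fun p hp => ?_)
    fun p hp => doubling_eq_smul_twistMap hc hp
  have := half_le_norm_twistParam (norm_untwist_le hp)
  positivity

theorem ContDiffOn.pairRotation {V : Type*} [NormedAddCommGroup V] [NormedSpace ℝ V] {K : Set V}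
    {a : V → ℝ} {f : V → ℂ × ℂ} (ha : ContDiffOn ℝ ∞ a K) (hf : ContDiffOn ℝ ∞ f K) :
    ContDiffOn ℝ ∞ (fun x => pairRotation (a x) (f x)) K :=
  contDiff_pairRotation.comp_contDiffOn (f := fun x => (a x, f x)) (ha.prodMk hf)

theorem ContDiffOn.twistMap {V : Type*} [NormedAddCommGroup V] [NormedSpace ℝ V] {K : Set V}
    {a τ δ : V → ℝ} {f : V → ℂ × ℂ} (ha : ContDiffOn ℝ ∞ a K) (hτ : ContDiffOn ℝ ∞ τ K)
    (hδ : ContDiffOn ℝ ∞ δ K) (hf : ContDiffOn ℝ ∞ f K) (hδ1 : ∀ x ∈ K, |δ x| < 1)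
    (hfK : MapsTo f K circleDisk) :
    ContDiffOn ℝ ∞ (fun x => twistMap (a x) (τ x) (δ x) (f x)) K := by
  have h : ContDiffOn ℝ ∞ (fun x => twistPhase (δ x) (f x)) K :=
    contDiffOn_twistPhase.comp (f := fun x => (δ x, f x)) (hδ.prodMk hf)
      fun x hx => ⟨hδ1 x hx, hfK hx⟩
  have h2 : ContDiffOn ℝ ∞ (fun x => (a x : ℂ) - (τ x : ℂ) * untwist (f x)) K :=
    (contDiff_complexOfReal.comp_contDiffOn ha).sub
      ((contDiff_complexOfReal.comp_contDiffOn hτ).mul (contDiff_untwist.comp_contDiffOn hf))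
  exact ((h.pow 2).mul h2).prodMk h

/-! ### From the spin embedding to the stereographic projection -/

/-- The denominator `√(1 + x² + s² y²) - x` interpolating between the spin embedding and the
stereographic projection. -/
noncomputable def interpDenom (s : ℝ) (z : ℂ) : ℝ := √(1 + z.re ^ 2 + s ^ 2 * z.im ^ 2) - z.re

theorem interpDenom_pos (s : ℝ) (z : ℂ) : 0 < interpDenom s z := by
  refine sub_pos.2 (Real.lt_sqrt_of_sq_lt ?_)
  nlinarith [sq_nonneg (s * z.im)]

theorem contDiff_interpDenom : ContDiff ℝ ∞ (fun q : ℝ × ℂ => interpDenom q.1 q.2) := by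
  have hre : ContDiff ℝ ∞ (fun q : ℝ × ℂ => q.2.re) := contDiff_complexRe.comp contDiff_snd
  have him : ContDiff ℝ ∞ (fun q : ℝ × ℂ => q.2.im) := contDiff_complexIm.comp contDiff_snd
  refine ContDiff.sub (ContDiff.sqrt (by fun_prop) fun q => ?_) hre
  positivity

/-- The interpolation between the spin embedding of the solid torus and the stereographic
projection. -/
noncomputable def interpEmb (s : ℝ) (p : ℂ × ℂ) : (Fin 1 → ℝ) × ℂ :=
  (fun _ => p.2.im * (1 - s + s * (interpDenom s p.2)⁻¹), (interpDenom s p.2)⁻¹ • p.1)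

theorem contDiff_interpEmb : ContDiff ℝ ∞ (fun q : ℝ × (ℂ × ℂ) => interpEmb q.1 q.2) := by
  have him : ContDiff ℝ ∞ (fun q : ℝ × (ℂ × ℂ) => q.2.2.im) :=
    contDiff_complexIm.comp contDiff_snd.snd
  have hD : ContDiff ℝ ∞ (fun q : ℝ × (ℂ × ℂ) => (interpDenom q.1 q.2.2)⁻¹) :=
    (contDiff_interpDenom.comp (contDiff_fst.prodMk contDiff_snd.snd)).inv
      fun q => (interpDenom_pos _ _).ne'
  unfold interpEmb
  fun_prop

/-- The height `y`, recovered from the value of `interpEmb s`. -/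
noncomputable def interpHeight (s : ℝ) (x : (Fin 1 → ℝ) × ℂ) : ℝ :=
  x.1 0 * (1 - s + s * ‖x.2‖)⁻¹

/-- A left inverse of `interpEmb s`. -/
noncomputable def interpInv (s : ℝ) (x : (Fin 1 → ℝ) × ℂ) : ℂ × ℂ :=
  (‖x.2‖⁻¹ • x.2,
    (((1 + s ^ 2 * interpHeight s x ^ 2) * ‖x.2‖ - ‖x.2‖⁻¹) / 2 : ℝ) +
      (interpHeight s x : ℂ) * Complex.I)

theorem interp_factor_pos {s r : ℝ} (hs : s ∈ Icc (0 : ℝ) 1) (hr : 0 < r) : 0 < 1 - s + s * r := by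
  rcases hs.1.eq_or_lt with h | h
  · simp [← h]
  · have := hs.2
    have := mul_pos h hr
    linarith

theorem contDiffOn_interpInv {s : ℝ} (hs : s ∈ Icc (0 : ℝ) 1) :
    ContDiffOn ℝ ∞ (interpInv s) {x | x.2 ≠ 0} := by
  have hn : ContDiffOn ℝ ∞ (fun x : (Fin 1 → ℝ) × ℂ => ‖x.2‖) {x | x.2 ≠ 0} :=
    (contDiffOn_norm_ne_zero (s := {z | z ≠ 0}) fun _ h => h).comp contDiffOn_snd fun _ h => h
  have hi := hn.inv fun x hx => norm_ne_zero_iff.2 hx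
  have hh : ContDiffOn ℝ ∞ (interpHeight s) {x | x.2 ≠ 0} := by
    refine ContDiffOn.mul (by fun_prop) (ContDiffOn.inv (by fun_prop) fun x hx => ?_)
    exact (interp_factor_pos hs (norm_pos_iff.2 hx)).ne'
  refine (hi.smul contDiffOn_snd).prodMk (ContDiffOn.add ?_ ?_)
  · exact contDiff_complexOfReal.comp_contDiffOn
      ((((contDiffOn_const.add (contDiffOn_const.mul (hh.pow 2))).mul hn).sub hi).div_const 2)
  · exact (contDiff_complexOfReal.comp_contDiffOn hh).mul contDiffOn_const

/-- The modulus of the complex coordinate is 1/D with D the denominator, which determines the height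
y; then (D + x)² = 1 + x² + s²y² is linear in x. -/
theorem interpInv_interpEmb {s : ℝ} (hs : s ∈ Icc (0 : ℝ) 1) {p : ℂ × ℂ} (hp : ‖p.1‖ = 1) :
    interpInv s (interpEmb s p) = p := by
  have hD := interpDenom_pos s p.2
  have hsq : (interpDenom s p.2 + p.2.re) ^ 2 = 1 + p.2.re ^ 2 + s ^ 2 * p.2.im ^ 2 := by
    rw [interpDenom, sub_add_cancel, Real.sq_sqrt (by positivity)]
  set D := interpDenom s p.2 with hDdef
  have hn : ‖(interpEmb s p).2‖ = D⁻¹ := by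
    rw [interpEmb, norm_smul, hp, mul_one, ← hDdef, Real.norm_of_nonneg (by positivity)]
  have hh : interpHeight s (interpEmb s p) = p.2.im := by
    rw [interpHeight, hn, interpEmb, ← hDdef,
      mul_inv_cancel_right₀ (interp_factor_pos hs (inv_pos.2 hD)).ne']
  rw [interpInv, hh, hn]
  refine Prod.ext ?_ ?_
  · rw [interpEmb, ← hDdef, inv_inv, smul_smul, mul_inv_cancel₀ hD.ne', one_smul]
  · have hre : ((1 + s ^ 2 * p.2.im ^ 2) * D⁻¹ - D⁻¹⁻¹) / 2 = p.2.re := by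
      field_simp
      linear_combination -hsq
    rw [hre]
    exact Complex.re_add_im _

/-- The spin embedding of the solid torus `𝕊¹ × 𝔻`. -/
noncomputable def circleSpin (p : ℂ × ℂ) : (Fin 1 → ℝ) × ℂ :=
  spin (n := 0) (p.1, (0, p.2))

/-- At s = 0 the reciprocal denominator is `halfLineMap`; at s = 1 the square root is the norm of
(θ, z), because |θ| = 1. -/
theorem circleSpin_isotopicOn_stereoProj : IsotopicOn circleSpin stereoProj circleDisk := by
  refine .of_family interpEmb contDiff_interpEmb.contDiffOn (fun s hs => ?_) (fun p hp => ?_)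
    fun p hp => ?_
  · refine .of_leftInvOn (U := {x | x.2 ≠ 0}) (interpInv s) ?_ (fun p hp => ?_)
      (contDiffOn_interpInv hs)
      fun p hp => interpInv_interpEmb hs (norm_fst_of_mem_circleDisk hp)
    · exact (contDiff_interpEmb.comp (contDiff_const.prodMk contDiff_id)).contDiffOn
    · have h1 := norm_fst_of_mem_circleDisk hp
      have h2 : p.1 ≠ 0 := by
        rw [← norm_ne_zero_iff, h1]
        exact one_ne_zero
      exact smul_ne_zero (inv_pos.2 (interpDenom_pos s p.2)).ne' h2
  · have h : (interpDenom 0 p.2)⁻¹ = halfLineMap p.2.re := by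
      refine inv_eq_of_mul_eq_one_left ?_
      rw [halfLineMap, interpDenom]
      have := Real.sq_sqrt (show 0 ≤ 1 + p.2.re ^ 2 by positivity)
      simp only [ne_eq, OfNat.ofNat_ne_zero, not_false_eq_true, zero_pow, zero_mul, add_zero]
      linear_combination this
    rw [interpEmb, h, circleSpin, spin]
    refine Prod.ext (funext fun i => ?_) (by simp)
    rw [Subsingleton.elim i 0]
    simp
  · have h : interpDenom 1 p.2 = √(pairNormSq p) - p.2.re := by
      rw [interpDenom, pairNormSq, Complex.normSq_eq_norm_sq p.1, norm_fst_of_mem_circleDisk hp,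
        Complex.normSq_apply]
      ring_nf
    rw [interpEmb, h, stereoProj]
    refine Prod.ext (funext fun i => ?_) (by simp)
    simp [mul_comm]

/-! ### The isotopy from the standard solid torus to the doubled one -/

theorem stereoProj_isotopicOn_half :
    IsotopicOn stereoProj (fun p => stereoProj (p.1, (1 / 2 : ℝ) • p.2)) circleDisk ∧
      RayEmbOn (fun p : ℂ × ℂ => (p.1, (1 / 2 : ℝ) • p.2)) circleDisk := by
  have hemb (c : ℝ) (hc : 0 < c) : RayEmbOn (fun p : ℂ × ℂ => (p.1, c • p.2)) circleDisk := by
    refine ⟨by fun_prop, fun y => (‖y.1‖⁻¹ • y.1, c⁻¹ • ‖y.1‖⁻¹ • y.2), {y | y.1 ≠ 0}, ?_,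
      fun p hp l hl => ?_⟩
    · have hn : ContDiffOn ℝ ∞ (fun y : ℂ × ℂ => ‖y.1‖) {y | y.1 ≠ 0} :=
        (contDiffOn_norm_ne_zero (s := {z | z ≠ 0}) fun _ h => h).comp contDiffOn_fst fun _ h => h
      have hi := hn.inv fun x hx => norm_ne_zero_iff.2 hx
      exact (hi.smul contDiffOn_fst).prodMk ((hi.smul contDiffOn_snd).const_smul c⁻¹)
    · have h1 := norm_fst_of_mem_circleDisk hp
      have h2 : p.1 ≠ 0 := by
        rw [← norm_ne_zero_iff, h1]
        exact one_ne_zero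
      have h3 : ‖l • p.1‖ = l := by rw [norm_smul, h1, mul_one, Real.norm_of_nonneg hl.le]
      refine ⟨smul_ne_zero hl.ne' h2, ?_⟩
      simp only [Prod.smul_mk, h3, smul_smul, inv_mul_cancel₀ hl.ne', one_smul]
      rw [show c⁻¹ * (l⁻¹ * (l * c)) = 1 by field_simp, one_smul]
  have hpos : ∀ t ∈ Icc (0 : ℝ) 1, 0 < 1 - t / 2 := fun t ht => by linarith [ht.2]
  refine ⟨(isotopicOn_stereoProj_of_family (fun t p => (p.1, (1 - t / 2) • p.2)) (by fun_prop)
    (fun t ht => hemb _ (hpos t ht)) fun t ht p hp h0 => ?_).congr (fun p _ => by simp)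
    fun p _ => ?_, hemb _ (by norm_num)⟩
  · have := norm_fst_of_mem_circleDisk hp
    simp [show p.1 = 0 from h0] at this
  · norm_num

theorem sin_cos_of_mem_Icc {t : ℝ} (ht : t ∈ Icc (0 : ℝ) 1) :
    0 ≤ Real.sin (t * (Real.pi / 2)) ∧ 0 ≤ Real.cos (t * (Real.pi / 2)) := by
  have hpi := Real.pi_pos
  have h0 : 0 ≤ t * (Real.pi / 2) := by have := ht.1; positivity
  have h1 : t * (Real.pi / 2) ≤ Real.pi / 2 := mul_le_of_le_one_left (by positivity) ht.2
  exact ⟨Real.sin_nonneg_of_nonneg_of_le_pi h0 (by linarith),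
    Real.cos_nonneg_of_mem_Icc ⟨by linarith, h1⟩⟩

/-- The quarter turn of the unrotated torus would end on the pole, at z = 0, θ = 1. Against the
rotated pole, a collision would give (c + s)θ = (s - c)z/2 with c, s ≥ 0 the cosine and sine; this
contradicts |z| ≤ 1, thanks to the preliminary shrinking of the disk by 1/2. -/
theorem rotated_isotopicOn_quarter_turn :
    IsotopicOn (fun p : ℂ × ℂ =>
        stereoProj (pairRotation (Real.pi / 4) (p.1, (1 / 2 : ℝ) • p.2)))
      (fun p : ℂ × ℂ => stereoProj (pairRotation (Real.pi / 4) (-((1 / 2 : ℝ) • p.2), p.1)))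
      circleDisk := by
  have hray (t : ℝ) : RayEmbOn (fun p : ℂ × ℂ =>
      pairRotation (-(t * (Real.pi / 2))) (p.1, (1 / 2 : ℝ) • p.2)) circleDisk :=
    stereoProj_isotopicOn_half.2.pairRotation _
  refine (isotopicOn_stereoProj_of_family (fun t (p : ℂ × ℂ) => pairRotation (Real.pi / 4)
    (pairRotation (-(t * (Real.pi / 2))) (p.1, (1 / 2 : ℝ) • p.2))) ?_
    (fun t _ => (hray t).pairRotation _)
    fun t ht p hp => ?_).congr (fun p _ => ?_) fun p _ => ?_
  · have h : ContDiffOn ℝ ∞ (fun q : ℝ × (ℂ × ℂ) =>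
        pairRotation (-(q.1 * (Real.pi / 2))) (q.2.1, (1 / 2 : ℝ) • q.2.2))
          (Icc 0 1 ×ˢ circleDisk) :=
      .pairRotation (by fun_prop) (by fun_prop)
    exact .pairRotation contDiffOn_const h
  · refine pairRotation_pi_div_four_mem_offPole fun h => ?_
    exfalso
    obtain ⟨hs, hc⟩ := sin_cos_of_mem_Icc ht
    simp only [pairRotation, Real.cos_neg, Real.sin_neg] at h
    set c := Real.cos (t * (Real.pi / 2))
    set s := Real.sin (t * (Real.pi / 2))
    have hsq : s ^ 2 + c ^ 2 = 1 := Real.sin_sq_add_cos_sq _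
    have h1 : (c + s) • p.1 = ((s - c) * (1 / 2)) • p.2 := by
      have h2 : (c + s) • p.1 - ((s - c) * (1 / 2)) • p.2 =
          (c • p.1 + -s • (1 / 2 : ℝ) • p.2) - -(c • (1 / 2 : ℝ) • p.2 - -s • p.1) := by module
      rw [← sub_eq_zero, h2, h, sub_self]
    have h2 := congrArg norm h1
    rw [norm_smul, norm_smul, norm_fst_of_mem_circleDisk hp, mul_one,
      Real.norm_of_nonneg (by positivity), norm_mul, Real.norm_eq_abs (s - c)] at h2
    have h3 : |s - c| ≤ c + s := abs_le.2 ⟨by linarith, by linarith⟩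
    have h4 := norm_snd_of_mem_circleDisk hp
    norm_num at h2
    have h5 : 0 < c + s := by
      by_contra! h6
      have h7 : c = 0 := by linarith
      have h8 : s = 0 := by linarith
      norm_num [h7, h8] at hsq
    nlinarith [abs_nonneg (s - c), norm_nonneg p.2]
  · simp [pairRotation]
  · simp [pairRotation]

/-- On the ray through (-1, 1) the unit second coordinate must be 1, and then τ Re v = 1 + a > τ,
impossible for |v| ≤ 1. -/
theorem rotated_twistMap_mem_offPole {a τ δ : ℝ} (hτ : 0 < τ) (ha : τ < 1 + a) (hδ : |δ| < 1)
    {p : ℂ × ℂ} (hp : p ∈ circleDisk) :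
    pairRotation (Real.pi / 4) (twistMap a τ δ p) ∈ offPole := by
  refine pairRotation_pi_div_four_mem_offPole fun h him => ?_
  by_contra! hre
  have hn := norm_twistPhase hδ hp
  simp only [twistMap] at h him hre
  have h1 : twistPhase δ p = 1 := by
    have h2 : ((twistPhase δ p).re : ℂ) = twistPhase δ p := Complex.ext rfl (by simp [him])
    rw [← h2, Complex.norm_real, Real.norm_of_nonneg hre] at hn
    rw [← h2, hn, Complex.ofReal_one]
  rw [h1] at h
  have h2 := congrArg Complex.re h
  simp only [one_pow, one_mul, Complex.sub_re, Complex.ofReal_re, Complex.re_ofReal_mul,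
    Complex.neg_re, Complex.one_re] at h2
  have h3 : (untwist p).re ≤ 1 := (Complex.re_le_norm _).trans (norm_untwist_le hp)
  nlinarith

/-- The parameters (a, τ, δ) run along the segment from (0, 1/2, 0) to (1/c, 1/(2c), 1/2), on which
τ < 1 + a. At the start the factor θ² cancels the twist θ⁻² in v; at the end the value is a positive
multiple of the doubling map. -/
theorem rotated_isotopicOn_doubling {c : ℝ} (hc : 0 < c) :
    IsotopicOn
      (fun p : ℂ × ℂ => stereoProj (pairRotation (Real.pi / 4) (-((1 / 2 : ℝ) • p.2), p.1)))
      (fun p => stereoProj (pairRotation (Real.pi / 4) (doubling c p))) circleDisk := by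
  have hc' := inv_pos.2 hc
  have hδ : ∀ t ∈ Icc (0 : ℝ) 1, |t / 2| < 1 := fun t ht =>
    abs_lt.2 ⟨by linarith [ht.1], by linarith [ht.2]⟩
  have hτ : ∀ t ∈ Icc (0 : ℝ) 1, 0 < (1 - t) * (1 / 2) + t * (c⁻¹ * (1 / 2)) := fun t ht => by
    rcases ht.1.eq_or_lt with h | h
    · simp [← h]
    · have := mul_pos h hc'
      linarith [ht.2]
  refine (isotopicOn_stereoProj_of_family (fun t p => pairRotation (Real.pi / 4)
    (twistMap (t * c⁻¹) ((1 - t) * (1 / 2) + t * (c⁻¹ * (1 / 2))) (t / 2) p)) ?_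
    (fun t ht => (rayEmbOn_twistMap (hτ t ht) (hδ t ht)).pairRotation _)
    fun t ht p hp => rotated_twistMap_mem_offPole (hτ t ht) ?_ (hδ t ht) hp).congr
      (fun p hp => ?_) fun p hp => ?_
  · exact .pairRotation contDiffOn_const (.twistMap (by fun_prop) (by fun_prop) (by fun_prop)
      contDiffOn_snd (fun q hq => hδ _ hq.1) fun q hq => hq.2)
  · have := mul_nonneg ht.1 hc'.le
    linarith [ht.1]
  · have h := sq_mul_untwist hp
    have h2 : twistMap (0 * c⁻¹) ((1 - 0) * (1 / 2) + 0 * (c⁻¹ * (1 / 2))) (0 / 2) p =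
        (-((1 / 2 : ℝ) • p.2), p.1) := by
      simp only [twistMap, twistPhase, twistParam, zero_div, Complex.ofReal_zero, zero_mul,
        sub_zero, unitSqrt_one, mul_one, one_mul, add_zero]
      refine Prod.ext ?_ rfl
      simp only [Complex.real_smul]
      linear_combination (-((1 / 2 : ℝ) : ℂ)) * h
    simp only [Function.comp_apply, h2]
  · have h2 := doubling_eq_smul_twistMap hc hp
    have hpos : 0 < c * ‖twistParam (1 / 2) (untwist p)‖⁻¹ := by
      have := half_le_norm_twistParam (norm_untwist_le hp)
      positivity
    simp only [Function.comp_apply, sub_self, zero_mul, zero_add, one_mul]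
    rw [h2, pairRotation_smul, stereoProj_smul hpos]

theorem norm_doubling_snd_le {c : ℝ} (hc : 0 ≤ c) {p : ℂ × ℂ} (hp : p ∈ circleDisk) :
    ‖(doubling c p).2‖ ≤ 2 * c := by
  have h := norm_doublingFibre_le (norm_untwist_le hp)
  rw [doubling, norm_smul, norm_mul, norm_fst_of_mem_circleDisk hp, one_mul,
    Real.norm_of_nonneg hc]
  nlinarith

theorem norm_doubling_fst (c : ℝ) {p : ℂ × ℂ} (hp : p ∈ circleDisk) :
    ‖(doubling c p).1‖ = 1 := by
  rw [doubling, norm_pow, norm_fst_of_mem_circleDisk hp, one_pow]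

theorem mapsTo_doubling {c : ℝ} (hc : 0 ≤ c) (hc2 : 2 * c < 1) :
    MapsTo (doubling c) circleDisk circleDisk := fun p hp =>
  ⟨by simpa using norm_doubling_fst c hp, by simpa using (norm_doubling_snd_le hc hp).trans hc2.le⟩

/-- Both ends are carried to the stereographic picture and rotated by π/4; for the doubled torus
this rotation is harmless because its second coordinate is at most 2c < 1. -/
theorem circleSpin_isotopicOn_doubling {c : ℝ} (hc : 0 < c) (hc2 : 2 * c < 1) :
    IsotopicOn circleSpin (circleSpin ∘ doubling c) circleDisk := by
  obtain ⟨h1, h2⟩ := stereoProj_isotopicOn_half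
  have h3 := h2.isotopicOn_pairRotation fun p hp => by
    have := norm_snd_of_mem_circleDisk hp
    rw [norm_fst_of_mem_circleDisk hp, norm_smul]
    norm_num
    linarith
  have h4 := (rayEmbOn_doubling hc).isotopicOn_pairRotation fun p hp => by
    rw [norm_doubling_fst c hp]
    exact (norm_doubling_snd_le hc.le hp).trans_lt hc2
  exact ((((circleSpin_isotopicOn_stereoProj.trans h1).trans h3).trans
    rotated_isotopicOn_quarter_turn).trans (rotated_isotopicOn_doubling hc)).trans
    (h4.symm.trans (circleSpin_isotopicOn_stereoProj.comp_right
      (rayEmbOn_doubling hc).smoothEmbOn (mapsTo_doubling hc.le hc2)).symm)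

/-! ### Contracting lifts of the squaring map -/

/-- The identification of `ℂ¹ × ℂ` with `ℂ × ℂ`. -/
def toPair (p : (Fin 1 → ℂ) × ℂ) : ℂ × ℂ := (p.1 0, p.2)

/-- The inverse of `toPair`. -/
def ofPair (p : ℂ × ℂ) : (Fin 1 → ℂ) × ℂ := (fun _ => p.1, p.2)

theorem ofPair_toPair (p : (Fin 1 → ℂ) × ℂ) : ofPair (toPair p) = p :=
  Prod.ext (funext fun i => by rw [Subsingleton.elim i 0]; rfl) rfl

theorem smoothEmbOn_toPair (K : Set ((Fin 1 → ℂ) × ℂ)) : SmoothEmbOn toPair K :=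
  .of_leftInvOn (U := univ) ofPair (by unfold toPair; fun_prop) (mapsTo_univ _ _)
    (by unfold ofPair; fun_prop) fun p _ => ofPair_toPair p

theorem smoothEmbOn_ofPair (K : Set (ℂ × ℂ)) : SmoothEmbOn ofPair K :=
  .of_leftInvOn (U := univ) toPair (by unfold ofPair; fun_prop) (mapsTo_univ _ _)
    (by unfold toPair; fun_prop) fun _ _ => rfl

theorem mapsTo_toPair : MapsTo toPair (solidTorusSet 1) circleDisk :=
  fun p hp => ⟨by simpa [toPair] using hp.1 0, by simpa [toPair] using hp.2⟩

theorem mapsTo_ofPair : MapsTo ofPair circleDisk (solidTorusSet 1) :=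
  fun _ hp => ⟨fun _ => norm_fst_of_mem_circleDisk hp, norm_snd_of_mem_circleDisk hp⟩

theorem isIsotopicToId_doubling {c : ℝ} (hc : 0 < c) (hc2 : 2 * c < 1) :
    IsIsotopicToId (ofPair ∘ doubling c ∘ toPair) where
  mapsTo := mapsTo_ofPair.comp ((mapsTo_doubling hc.le hc2).comp mapsTo_toPair)
  smoothEmbOn := (smoothEmbOn_ofPair _).comp ((rayEmbOn_doubling hc).smoothEmbOn.comp
    (smoothEmbOn_toPair _) mapsTo_toPair) (mapsTo_univ _ _)
  isotopicOn := ((circleSpin_isotopicOn_doubling hc hc2).comp_right (smoothEmbOn_toPair _)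
    mapsTo_toPair).congr (fun p _ => by
      simp only [Function.comp_apply, circleSpin, spinEmb, splitFirst, toPair])
    fun p _ => by
      simp only [Function.comp_apply, circleSpin, spinEmb, splitFirst, toPair, ofPair]

/-- A self-embedding of the solid torus that is isotopic to the identity, acts on the torus by
`σ`, and contracts the fibres at rate at most `lam`. -/
structure IsContractingLift {k : ℕ} (lam : ℝ) (σ : (Fin k → ℂ) → Fin k → ℂ)
    (φ : (Fin k → ℂ) × ℂ → (Fin k → ℂ) × ℂ) : Prop extends IsIsotopicToId φ where
  fst_eq : ∀ p ∈ solidTorusSet k, (φ p).1 = σ p.1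
  norm_snd_lt : ∀ p ∈ solidTorusSet k, ‖(φ p).2‖ < 1
  dist_snd_le : ∀ p ∈ solidTorusSet k, ∀ q ∈ solidTorusSet k, p.1 = q.1 →
    dist (φ p).2 (φ q).2 ≤ lam * dist p.2 q.2

theorem exists_isContractingLift_doubling {lam : ℝ} (hlam : 0 < lam) :
    ∃ φ, IsContractingLift (k := 1) lam (fun w i => w i ^ 2) φ := by
  obtain ⟨C, hC⟩ := exists_lipschitzOnWith_doublingFibre
  have hC1 : (0 : ℝ) < C + 1 := by positivity
  obtain ⟨c, hc, hc2, hcC⟩ : ∃ c : ℝ, 0 < c ∧ 2 * c < 1 ∧ c * C ≤ lam := by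
    -- The bound 1/4 keeps the image in the open disk; C + 1 avoids division by zero.
    refine ⟨min (1 / 4) (lam / (C + 1)), by positivity, ?_, ?_⟩
    · linarith [min_le_left (1 / 4) (lam / (C + 1))]
    · have h1 := min_le_right (1 / 4) (lam / (C + 1))
      have h2 : lam / (C + 1) * C ≤ lam := by
        rw [div_mul_eq_mul_div, div_le_iff₀ hC1]
        nlinarith
      exact (mul_le_mul_of_nonneg_right h1 C.coe_nonneg).trans h2
  refine ⟨_, isIsotopicToId_doubling hc hc2, fun p _ => ?_, fun p hp => ?_,
    fun p hp q hq hpq => ?_⟩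
  · funext i
    rw [Subsingleton.elim i 0]
    rfl
  · exact (norm_doubling_snd_le hc.le (mapsTo_toPair hp)).trans_lt hc2
  · have hp' := mapsTo_toPair hp
    have hq' := mapsTo_toPair hq
    have h1 := hC.dist_le_mul (untwist (toPair p)) (by simpa using norm_untwist_le hp')
      (untwist (toPair q)) (by simpa using norm_untwist_le hq')
    have hnp := norm_fst_of_mem_circleDisk hp'
    have hfst : (toPair q).1 = (toPair p).1 := by simp only [toPair, hpq]
    have h2 : dist (untwist (toPair p)) (untwist (toPair q)) = dist p.2 q.2 := by
      rw [dist_eq_norm, dist_eq_norm, untwist, untwist, hfst, ← sub_mul, norm_mul, norm_pow,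
        RCLike.norm_conj, hnp]
      simp [toPair]
    rw [h2] at h1
    simp only [Function.comp_apply, ofPair, doubling]
    rw [dist_eq_norm, hfst, ← smul_sub, ← mul_sub, norm_smul, norm_mul, hnp, one_mul,
      Real.norm_of_nonneg hc.le, ← dist_eq_norm]
    calc c * _ ≤ c * (C * dist p.2 q.2) := mul_le_mul_of_nonneg_left h1 hc.le
      _ = c * C * dist p.2 q.2 := by ring
      _ ≤ _ := mul_le_mul_of_nonneg_right hcC dist_nonneg

theorem exists_isContractingLift_first {lam : ℝ} (hlam : 0 < lam) (k : ℕ) :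
    ∃ φ, IsContractingLift (k := k + 1) lam
      (fun w => (Fin.cons (w 0 ^ 2) (Fin.tail w) : Fin (k + 1) → ℂ)) φ := by
  induction k with
  | zero =>
    obtain ⟨φ, hφ⟩ := exists_isContractingLift_doubling hlam
    refine ⟨φ, hφ.toIsIsotopicToId, fun p hp => ?_, hφ.norm_snd_lt, hφ.dist_snd_le⟩
    rw [hφ.fst_eq p hp]
    funext i
    rw [Subsingleton.elim i 0]
    rfl
  | succ k ih =>
    obtain ⟨φ, hφ⟩ := ih
    have hs := isIsotopicToId_swapConj k
    have hm : ∀ p ∈ solidTorusSet (k + 2),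
        (splitFirst (swapConj p)).2 ∈ solidTorusSet (k + 1) := fun p hp =>
      (mapsTo_splitFirst _ (hs.mapsTo hp)).2
    -- In `circleProd φ` the doubled circle is the second one; conjugating by the involution
    -- `swapConj` brings it to the front, and the two disk conjugations are isometries.
    refine ⟨swapConj ∘ circleProd φ ∘ swapConj,
      hs.comp (hφ.toIsIsotopicToId.circleProd.comp hs), fun p hp => ?_, fun p hp => ?_,
      fun p hp q hq hpq => ?_⟩
    · have h := hφ.fst_eq _ (hm p hp)
      have hsw (i : Fin k) : Equiv.swap (0 : Fin (k + 2)) 1 i.succ.succ = i.succ.succ :=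
        Equiv.swap_apply_of_ne_of_ne (Fin.succ_ne_zero _) (by simp [Fin.ext_iff])
      simp only [Function.comp_apply, swapConj, circleProd, consFirst, splitFirst] at h ⊢
      rw [h]
      funext i
      refine Fin.cases ?_ (fun j => Fin.cases ?_ (fun l => ?_) j) i
      · simp
      · simp [Fin.tail]
      · simp [Fin.tail, hsw]
    · have h := hφ.norm_snd_lt _ (hm p hp)
      simpa [swapConj, circleProd, consFirst] using h
    · have hfst : (splitFirst (swapConj p)).2.1 = (splitFirst (swapConj q)).2.1 := by
        simp only [splitFirst, swapConj, hpq]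
      have h := hφ.dist_snd_le _ (hm p hp) _ (hm q hq) hfst
      have hd (a b : ℂ) : dist (starRingEnd ℂ a) (starRingEnd ℂ b) = dist a b := by
        rw [dist_eq_norm, ← map_sub, RCLike.norm_conj, dist_eq_norm]
      simp only [Function.comp_apply, swapConj, circleProd, consFirst, hd]
      simpa only [splitFirst, swapConj, hd] using h

theorem exists_isContractingLift_sq {lam : ℝ} (hlam : 0 < lam) (hlam1 : lam < 1) (k : ℕ) :
    ∃ φ, IsContractingLift (k := k + 1) lam (fun w i => w i ^ 2) φ := by
  induction k with
  | zero => exact exists_isContractingLift_doubling hlam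
  | succ k ih =>
    obtain ⟨φ, hφ⟩ := exists_isContractingLift_first hlam (k + 1)
    obtain ⟨ψ, hψ⟩ := ih
    have hψ' := hψ.toIsIsotopicToId.circleProd
    have hm : ∀ p ∈ solidTorusSet (k + 2), (splitFirst p).2 ∈ solidTorusSet (k + 1) :=
      fun p hp => (mapsTo_splitFirst _ hp).2
    have hfst : ∀ p ∈ solidTorusSet (k + 2), (circleProd ψ p).1 =
        Fin.cons (p.1 0) (fun i => p.1 i.succ ^ 2) := fun p hp => by
      have h := hψ.fst_eq _ (hm p hp)
      simp only [circleProd, consFirst, h]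
      rfl
    -- The inner map squares every circle but the first, and the outer one squares the first. The
    -- rates multiply, and lam² ≤ lam.
    refine ⟨φ ∘ circleProd ψ, hφ.toIsIsotopicToId.comp hψ', fun p hp => ?_, fun p hp => ?_,
      fun p hp q hq hpq => ?_⟩
    · rw [Function.comp_apply, hφ.fst_eq _ (hψ'.mapsTo hp), hfst p hp]
      funext i
      refine Fin.cases ?_ (fun j => ?_) i <;> simp
    · exact hφ.norm_snd_lt _ (hψ'.mapsTo hp)
    · have h1 := hφ.dist_snd_le _ (hψ'.mapsTo hp) _ (hψ'.mapsTo hq) (by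
        rw [hfst p hp, hfst q hq, hpq])
      have h2 := hψ.dist_snd_le _ (hm p hp) _ (hm q hq) (by simp only [splitFirst, hpq])
      have h3 : dist (circleProd ψ p).2 (circleProd ψ q).2 ≤ lam * dist p.2 q.2 := h2
      refine h1.trans ?_
      have h4 : 0 ≤ dist p.2 q.2 := dist_nonneg
      calc _ ≤ lam * (lam * dist p.2 q.2) := mul_le_mul_of_nonneg_left h3 hlam.le
        _ ≤ 1 * (lam * dist p.2 q.2) := by gcongr
        _ = _ := one_mul _

-- The torus as a submanifold of ℂ^k

attribute [local instance] finrank_real_complex_fact'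

theorem contMDiff_circle_coe : ContMDiff (𝓡 1) 𝓘(ℝ, ℂ) ∞ (fun z : Circle => (z : ℂ)) :=
  contMDiff_coe_sphere (E := ℂ) (n := 1)

theorem mfderiv_circle_coe_injective (z : Circle) :
    Function.Injective (mfderiv (𝓡 1) 𝓘(ℝ, ℂ) (fun z : Circle => (z : ℂ)) z) := by
  convert! injective_mvfderiv_subtypeVal_sphere (E := ℂ) (n := 1) z

section Torus

variable {k : ℕ} {E H M : Type*} [NormedAddCommGroup E] [NormedSpace ℝ E] [TopologicalSpace H]
  [TopologicalSpace M] [ChartedSpace H M] {I : ModelWithCorners ℝ E H}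

theorem contMDiffWithinAt_torus_iff {f : M → Torus k} {s : Set M} {x : M} :
    ContMDiffWithinAt I (ModelWithCorners.pi fun _ : Fin k => 𝓡 1) ∞ f s x ↔
      ∀ i, ContMDiffWithinAt I (𝓡 1) ∞ (fun y => f y i) s x := by
  have h (i : Fin k) : ContMDiffWithinAt I (𝓡 1) ∞ (fun y => f y i) s x ↔
      ContinuousWithinAt (fun y => f y i) s x ∧
        ContMDiffWithinAt I 𝓘(ℝ, EuclideanSpace ℝ (Fin 1)) ∞
          (extChartAt (𝓡 1) (f x i) ∘ fun y => f y i) s x := contMDiffWithinAt_iff_target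
  rw [contMDiffWithinAt_iff_target, continuousWithinAt_pi]
  simp only [h, forall_and]
  refine and_congr_right fun _ => ?_
  exact contMDiffWithinAt_pi_space

theorem contMDiff_torus_apply (i : Fin k) :
    ContMDiff (ModelWithCorners.pi fun _ : Fin k => 𝓡 1) (𝓡 1) ∞ (fun Θ : Torus k => Θ i) :=
  fun x => contMDiffWithinAt_torus_iff.1 (contMDiff_id x) i

/-- In product charts the coordinate map reads as a linear projection. -/
theorem hasMFDerivAt_torus_apply (i : Fin k) (Θ : Torus k) :
    HasMFDerivAt (ModelWithCorners.pi fun _ : Fin k => 𝓡 1) (𝓡 1) (fun Θ : Torus k => Θ i) Θ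
      (ContinuousLinearMap.proj (R := ℝ) (φ := fun _ : Fin k => EuclideanSpace ℝ (Fin 1)) i) := by
  refine ⟨(continuous_apply i).continuousAt, ?_⟩
  refine (ContinuousLinearMap.proj (R := ℝ)
    (φ := fun _ : Fin k => EuclideanSpace ℝ (Fin 1)) i).hasFDerivAt.hasFDerivWithinAt
    |>.congr_of_eventuallyEq ?_ ?_
  · filter_upwards [extChartAt_target_mem_nhdsWithin
      (I := ModelWithCorners.pi fun _ : Fin k => 𝓡 1) Θ] with y hy
    exact congrFun ((extChartAt (ModelWithCorners.pi fun _ : Fin k => 𝓡 1) Θ).right_inv hy) i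
  · exact congrFun ((extChartAt (ModelWithCorners.pi fun _ : Fin k => 𝓡 1) Θ).right_inv
      (mem_extChartAt_target Θ)) i

/-- The inclusion of `𝕋^k × ℂ` into `ℂ^k × ℂ`. -/
def torusIncl (p : Torus k × ℂ) : (Fin k → ℂ) × ℂ := (fun i => (p.1 i : ℂ), p.2)

theorem contMDiff_torusIncl :
    ContMDiff (solidTorusModel k) 𝓘(ℝ, (Fin k → ℂ) × ℂ) ∞ (torusIncl (k := k)) := by
  refine ContMDiff.prodMk_space ?_ contMDiff_snd
  rw [contMDiff_pi_space]
  exact fun i => contMDiff_circle_coe.comp ((contMDiff_torus_apply i).comp contMDiff_fst)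

/-- Each component of a kernel vector is tested separately: projecting the inclusion to one
coordinate gives either the identity of ℂ or the immersion of a circle. -/
theorem mfderiv_torusIncl_injective (p : Torus k × ℂ) :
    Function.Injective (mfderiv (solidTorusModel k) 𝓘(ℝ, (Fin k → ℂ) × ℂ) torusIncl p) := by
  rw [injective_iff_map_eq_zero]
  rintro ⟨u, ζ⟩ h
  have hj := ((contMDiff_torusIncl (k := k)).mdifferentiable (by simp) p).hasMFDerivAt
  have hz : ζ = 0 := by
    have h1 := (ContinuousLinearMap.snd ℝ (Fin k → ℂ) ℂ).hasMFDerivAt.comp p hj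
    have h2 := hasMFDerivAt_snd (I := ModelWithCorners.pi fun _ : Fin k => 𝓡 1)
      (I' := 𝓘(ℝ, ℂ)) p
    have h3 := congrArg (fun L => L (u, ζ)) (hasMFDerivAt_unique h1 h2)
    exact h3.symm.trans ((congrArg Prod.snd h).trans rfl)
  have hu : u = 0 := by
    funext i
    have h1 := ((ContinuousLinearMap.proj (R := ℝ) (φ := fun _ : Fin k => ℂ) i).comp
      (ContinuousLinearMap.fst ℝ (Fin k → ℂ) ℂ)).hasMFDerivAt.comp p hj
    have h2 := ((contMDiff_circle_coe.mdifferentiable (by simp) (p.1 i)).hasMFDerivAt.comp p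
      ((hasMFDerivAt_torus_apply i p.1).comp p (hasMFDerivAt_fst
        (I := ModelWithCorners.pi fun _ : Fin k => 𝓡 1) (I' := 𝓘(ℝ, ℂ)) p)))
    have h3 := congrArg (fun L => L (u, ζ)) (hasMFDerivAt_unique h1 h2)
    have h4 : mfderiv (𝓡 1) 𝓘(ℝ, ℂ) (fun z : Circle => (z : ℂ)) (p.1 i) (u i) = 0 :=
      h3.symm.trans (congrFun (congrArg Prod.fst h) i)
    exact (injective_iff_map_eq_zero _).1 (mfderiv_circle_coe_injective (p.1 i)) _ h4
  rw [hz, hu]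
  rfl

end Torus

/-! ### Transfer to the manifold and to the ball -/

section SolidTorus

variable {k : ℕ}

theorem mapsTo_torusIncl : MapsTo torusIncl (solidTorus k) (solidTorusSet k) :=
  fun p hp => ⟨fun i => Circle.norm_coe (p.1 i), by simpa [torusIncl, closedUnitDisk] using hp.2⟩

theorem torusIncl_injective : Function.Injective (torusIncl (k := k)) := fun _ _ h =>
  Prod.ext (funext fun i => Circle.ext (congrFun (congrArg Prod.fst h) i))
    (congrArg (Prod.snd : (Fin k → ℂ) × ℂ → ℂ) h)

theorem isCompact_solidTorus : IsCompact (solidTorus k) :=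
  isCompact_univ.prod (isCompact_closedBall (0 : ℂ) 1)

theorem uniqueMDiffOn_solidTorus : UniqueMDiffOn (solidTorusModel k) (solidTorus k) := by
  refine uniqueMDiffOn_univ.prod ?_
  refine (uniqueDiffOn_convex (convex_closedBall (0 : ℂ) 1) ?_).uniqueMDiffOn
  rw [interior_closedBall (0 : ℂ) one_ne_zero]
  exact ⟨0, by simp⟩

variable {V E H N : Type*} [NormedAddCommGroup V] [NormedSpace ℝ V]
  [NormedAddCommGroup E] [NormedSpace ℝ E] [TopologicalSpace H]
  [TopologicalSpace N] [ChartedSpace H N] {J : ModelWithCorners ℝ E H}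

theorem isSmoothEmbeddingOn_of_smoothEmbOn [T2Space N] {f : Torus k × ℂ → N} {ι : N → V}
    (hι : ContMDiff J 𝓘(ℝ, V) ∞ ι) {g : (Fin k → ℂ) × ℂ → V}
    (hg : SmoothEmbOn g (solidTorusSet k))
    (hfg : ∀ p ∈ solidTorus k, ι (f p) = g (torusIncl p))
    (hf : ContMDiffOn (solidTorusModel k) J ∞ f (solidTorus k)) :
    IsSmoothEmbeddingOn (solidTorusModel k) J f (solidTorus k) := by
  refine ⟨hf, fun x hx => ?_, ?_⟩
  · obtain ⟨L, hL, hLg⟩ := hg.exists_leftInvOn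
    have hfx := (hf.mdifferentiableOn (by simp) x hx).hasMFDerivWithinAt
    have hιx := (hι.mdifferentiable (by simp) (f x)).hasMFDerivAt
    have hmem : solidTorus k ⊆ (ι ∘ f) ⁻¹' (g '' solidTorusSet k) := fun p hp =>
      ⟨torusIncl p, mapsTo_torusIncl hp, (hfg p hp).symm⟩
    have hLx : HasMFDerivWithinAt 𝓘(ℝ, V) 𝓘(ℝ, (Fin k → ℂ) × ℂ) L (g '' solidTorusSet k)
        (ι (f x)) (fderivWithin ℝ L (g '' solidTorusSet k) (ι (f x))) :=
      ((hL.differentiableOn (by simp)) _ (hmem hx)).hasFDerivWithinAt.hasMFDerivWithinAt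
    have h1 := HasMFDerivWithinAt.comp x hLx (hιx.comp_hasMFDerivWithinAt x hfx) hmem
    have h2 := ((contMDiff_torusIncl (k := k)).mdifferentiable
      (by simp) x).hasMFDerivAt.hasMFDerivWithinAt (s := solidTorus k)
    have h3 := h2.congr_of_eventuallyEq (f₁ := L ∘ ι ∘ f)
      (by
        filter_upwards [self_mem_nhdsWithin] with p hp
        simp only [Function.comp_apply, hfg p hp, hLg (mapsTo_torusIncl hp)])
      (by simp only [Function.comp_apply, hfg x hx, hLg (mapsTo_torusIncl hx)])
    have h4 := (uniqueMDiffOn_solidTorus x hx).eq h1 h3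
    intro u v huv
    refine mfderiv_torusIncl_injective x ?_
    have h5 : ∀ w, mfderiv (solidTorusModel k) 𝓘(ℝ, (Fin k → ℂ) × ℂ) torusIncl x w = _ :=
      fun w => (congrArg (fun T => T w) h4).symm
    refine (h5 u).trans (Eq.trans ?_ (h5 v).symm)
    exact congrArg (fun w => fderivWithin ℝ L (g '' solidTorusSet k) (ι (f x))
      (mfderiv J 𝓘(ℝ, V) ι (f x) w)) huv
  -- A continuous injection from a compact space to a Hausdorff space is a closed embedding.
  · have : CompactSpace (solidTorus k) := isCompact_iff_compactSpace.1 isCompact_solidTorus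
    refine (Continuous.isClosedEmbedding (hf.continuousOn.domRestrict) ?_).isEmbedding
    rintro ⟨p, hp⟩ ⟨q, hq⟩ h
    have h1 : ι (f p) = ι (f q) := congrArg ι h
    rw [hfg p hp, hfg q hq] at h1
    exact Subtype.ext (torusIncl_injective
      (hg.injOn (mapsTo_torusIncl hp) (mapsTo_torusIncl hq) h1))

theorem SmoothEmbOn.isSmoothEmbeddingOn {g : (Fin k → ℂ) × ℂ → V}
    (hg : SmoothEmbOn g (solidTorusSet k)) :
    IsSmoothEmbeddingOn (solidTorusModel k) 𝓘(ℝ, V) (g ∘ torusIncl) (solidTorus k) :=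
  isSmoothEmbeddingOn_of_smoothEmbOn contMDiff_id hg (fun _ _ => rfl)
    (hg.contDiffOn.contMDiffOn.comp contMDiff_torusIncl.contMDiffOn mapsTo_torusIncl)

theorem contMDiffOn_family {G : ℝ → (Fin k → ℂ) × ℂ → V}
    (hG : ContDiffOn ℝ ∞ (fun q : ℝ × ((Fin k → ℂ) × ℂ) => G q.1 q.2) (univ ×ˢ solidTorusSet k))
    (T : Set ℝ) :
    ContMDiffOn (𝓘(ℝ, ℝ).prod (solidTorusModel k)) 𝓘(ℝ, V) ∞
      (fun q : ℝ × (Torus k × ℂ) => G q.1 (torusIncl q.2)) (T ×ˢ solidTorus k) := by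
  have h : ContMDiff (𝓘(ℝ, ℝ).prod (solidTorusModel k)) 𝓘(ℝ, ℝ × ((Fin k → ℂ) × ℂ)) ∞
      (fun q : ℝ × (Torus k × ℂ) => (q.1, torusIncl q.2)) :=
    contMDiff_fst.prodMk_space (contMDiff_torusIncl.comp contMDiff_snd)
  have hm : T ×ˢ solidTorus k ⊆ (fun q : ℝ × (Torus k × ℂ) => (q.1, torusIncl q.2)) ⁻¹'
      (univ ×ˢ solidTorusSet k) := fun q hq => ⟨mem_univ _, mapsTo_torusIncl hq.2⟩
  exact hG.contMDiffOn.comp h.contMDiffOn hm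

theorem finrank_pi_prod_complex (k : ℕ) : Module.finrank ℝ ((Fin k → ℝ) × ℂ) =
    Module.finrank ℝ (EuclideanSpace ℝ (Fin (k + 2))) := by simp

/-- A diffeomorphism from `ℝ^k × ℂ` onto the unit ball of `ℝ^(k+2)`. -/
noncomputable def toUnitBall (k : ℕ) (x : (Fin k → ℝ) × ℂ) : EuclideanSpace ℝ (Fin (k + 2)) :=
  OpenPartialHomeomorph.univUnitBall
    (ContinuousLinearEquiv.ofFinrankEq (finrank_pi_prod_complex k) x)

theorem toUnitBall_mem (x : (Fin k → ℝ) × ℂ) : toUnitBall k x ∈ openUnitBall (k + 2) :=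
  OpenPartialHomeomorph.univUnitBall.map_source (mem_univ _)

theorem smoothEmbOn_toUnitBall : SmoothEmbOn (toUnitBall k) univ := by
  refine SmoothEmbOn.comp (g := OpenPartialHomeomorph.univUnitBall) (K' := univ) ?_
    (ContinuousLinearEquiv.smoothEmbOn _ _) (mapsTo_univ _ _)
  exact .of_leftInvOn _ OpenPartialHomeomorph.contDiff_univUnitBall.contDiffOn
    (fun x _ => OpenPartialHomeomorph.univUnitBall.map_source (mem_univ _))
    OpenPartialHomeomorph.contDiffOn_univUnitBall_symm
    fun x _ => OpenPartialHomeomorph.univUnitBall.left_inv (mem_univ _)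

theorem torusIncl_solenoidMap {lam : ℝ} {φ : (Fin k → ℂ) × ℂ → (Fin k → ℂ) × ℂ}
    (hφ : IsContractingLift lam (fun w i => w i ^ 2) φ) {p : Torus k × ℂ}
    (hp : p ∈ solidTorus k) :
    torusIncl (solenoidMap (fun Θ z => (φ (torusIncl (Θ, z))).2) p) = φ (torusIncl p) := by
  refine Prod.ext ?_ rfl
  rw [hφ.fst_eq _ (mapsTo_torusIncl hp)]
  funext i
  simp [torusIncl, solenoidMap, torusSquaring]

theorem IsContractingLift.isSmaleSolenoid {lam : ℝ} {φ : (Fin k → ℂ) × ℂ → (Fin k → ℂ) × ℂ}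
    (hφ : IsContractingLift lam (fun w i => w i ^ 2) φ) :
    IsSmaleSolenoid lam (fun Θ z => (φ (torusIncl (Θ, z))).2) where
  mapsTo Θ z hz := by
    simpa using hφ.norm_snd_lt _ (mapsTo_torusIncl (x := (Θ, z)) ⟨mem_univ _, hz⟩)
  contraction Θ z hz w hw := hφ.dist_snd_le _ (mapsTo_torusIncl (x := (Θ, z)) ⟨mem_univ _, hz⟩) _
    (mapsTo_torusIncl (x := (Θ, w)) ⟨mem_univ _, hw⟩) rfl
  embedding := by
    refine isSmoothEmbeddingOn_of_smoothEmbOn contMDiff_torusIncl hφ.smoothEmbOn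
      (fun p hp => torusIncl_solenoidMap hφ hp) (ContMDiffOn.prodMk ?_ ?_)
    · intro p hp
      rw [contMDiffWithinAt_torus_iff]
      intro i
      exact ((((contMDiff_torus_apply i).comp contMDiff_fst).pow 2) p).contMDiffWithinAt
    · exact (contDiff_snd.comp_contDiffOn hφ.smoothEmbOn.contDiffOn).contMDiffOn.comp
        contMDiff_torusIncl.contMDiffOn mapsTo_torusIncl

theorem mapsTo_solenoidMap {lam : ℝ} {A : Torus k → ℂ → ℂ} (hA : IsSmaleSolenoid lam A) :
    MapsTo (solenoidMap A) (solidTorus k) (solidTorus k) := fun p hp =>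
  ⟨mem_univ _, ball_subset_closedBall (hA.mapsTo p.1 hp.2)⟩

theorem leafProjection_apply {X : Type*} {e : Torus k × ℂ → X} (he : InjOn e (solidTorus k))
    {p : Torus k × ℂ} (hp : p ∈ solidTorus k) : leafProjection e (e p) = e (p.1, 0) := by
  rw [leafProjection, he.leftInvOn_invFunOn hp]

end SolidTorus

/-! ### Assembly of the solenoid and its isotopy in the ball -/

theorem mainTheorem7 (k : ℕ) (hk : 1 ≤ k) (lam : ℝ) (hlam0 : 0 < lam) (hlam1 : lam < 1) :
    ∃ (A : Torus k → ℂ → ℂ)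
      (e : Torus k × ℂ → EuclideanSpace ℝ (Fin (k + 2)))
      (S : EuclideanSpace ℝ (Fin (k + 2)) → EuclideanSpace ℝ (Fin (k + 2))),
      -- `s = solenoidMap A` is a Smale solenoid map covering the squaring map
      IsSmaleSolenoid lam A ∧
      -- `e` is a smooth embedding of the solid torus into the open unit ball
      IsSmoothEmbeddingOn (solidTorusModel k) 𝓘(ℝ, EuclideanSpace ℝ (Fin (k + 2))) e
        (solidTorus k) ∧
      MapsTo e (solidTorus k) (openUnitBall (k + 2)) ∧
      -- the commutative diagram `S ∘ e = e ∘ s`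
      MapsTo S (e '' solidTorus k) (e '' solidTorus k) ∧
      (∀ p ∈ solidTorus k, S (e p) = e (solenoidMap A p)) ∧
      -- the projection along the leaves, and `S` covers the squaring map under it
      (∀ Θ : Torus k, ∀ w ∈ stableLeaf e Θ, leafProjection e w = e (Θ, 0)) ∧
      (∀ Θ : Torus k, ∀ w ∈ stableLeaf e Θ, leafProjection e (S w) = e (torusSquaring Θ, 0)) ∧
      -- the isotopy `e_t`, `t ∈ [0, 1]`, from `e` to `e ∘ s` inside the ball
      ∃ F : ℝ → Torus k × ℂ → EuclideanSpace ℝ (Fin (k + 2)),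
        ContMDiffOn (𝓘(ℝ, ℝ).prod (solidTorusModel k)) 𝓘(ℝ, EuclideanSpace ℝ (Fin (k + 2))) ∞
          (fun q : ℝ × (Torus k × ℂ) => F q.1 q.2) (Icc 0 1 ×ˢ solidTorus k) ∧
        (∀ t ∈ Icc (0 : ℝ) 1,
          IsSmoothEmbeddingOn (solidTorusModel k) 𝓘(ℝ, EuclideanSpace ℝ (Fin (k + 2))) (F t)
            (solidTorus k) ∧
          MapsTo (F t) (solidTorus k) (openUnitBall (k + 2))) ∧
        (∀ p ∈ solidTorus k, F 0 p = e p) ∧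
        (∀ p ∈ solidTorus k, F 1 p = e (solenoidMap A p)) := by

  obtain ⟨n, rfl⟩ : ∃ n, k = n + 1 := ⟨k - 1, by omega⟩
  obtain ⟨φ, hφ⟩ := exists_isContractingLift_sq hlam0 hlam1 n
  have hA := hφ.isSmaleSolenoid
  have hs := mapsTo_solenoidMap hA
  have hsφ := fun p hp => torusIncl_solenoidMap hφ (p := p) hp
  set A : Torus (n + 1) → ℂ → ℂ := fun Θ z => (φ (torusIncl (Θ, z))).2
  set e : Torus (n + 1) × ℂ → EuclideanSpace ℝ (Fin (n + 1 + 2)) :=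
    (toUnitBall (n + 1) ∘ spinEmb (n + 1)) ∘ torusIncl with he_def
  have he := (smoothEmbOn_toUnitBall.comp (smoothEmbOn_spinEmb (n + 1))
    (mapsTo_univ _ _)).isSmoothEmbeddingOn
  rw [← he_def] at he
  have hinj : InjOn e (solidTorus (n + 1)) := injOn_iff_injective.2 he.embedding.injective
  -- Injectivity of `e` on the solid torus makes the chosen preimage the true one, so S is the
  -- conjugate of the solenoid map there.
  set S : EuclideanSpace ℝ (Fin (n + 1 + 2)) → EuclideanSpace ℝ (Fin (n + 1 + 2)) :=
    fun w => e (solenoidMap A (Function.invFunOn e (solidTorus (n + 1)) w)) with hS_def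
  have hS : ∀ p ∈ solidTorus (n + 1), S (e p) = e (solenoidMap A p) := fun p hp => by
    simp only [hS_def, hinj.leftInvOn_invFunOn hp]
  refine ⟨A, e, S, hA, he, fun p _ => toUnitBall_mem _, ?_, hS, ?_, ?_, ?_⟩
  · rintro _ ⟨p, hp, rfl⟩
    rw [hS p hp]
    exact mem_image_of_mem e (hs hp)
  · rintro Θ _ ⟨⟨Θ', z⟩, ⟨hΘ, hz⟩, rfl⟩
    obtain rfl : Θ' = Θ := hΘ
    exact leafProjection_apply hinj ⟨mem_univ _, hz⟩
  · rintro Θ _ ⟨⟨Θ', z⟩, ⟨hΘ, hz⟩, rfl⟩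
    obtain rfl : Θ' = Θ := hΘ
    have hp : (Θ', z) ∈ solidTorus (n + 1) := ⟨mem_univ _, hz⟩
    rw [hS _ hp]
    exact leafProjection_apply hinj (hs hp)
  · obtain ⟨F, hF, hemb, h0, h1⟩ := hφ.isotopicOn
    refine ⟨fun t => (toUnitBall (n + 1) ∘ F t) ∘ torusIncl, ?_, fun t _ =>
      ⟨(smoothEmbOn_toUnitBall.comp (hemb t) (mapsTo_univ _ _)).isSmoothEmbeddingOn,
        fun p _ => toUnitBall_mem _⟩, fun p hp => ?_, fun p hp => ?_⟩
    · exact contMDiffOn_family (G := fun t p => toUnitBall (n + 1) (F t p))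
        (smoothEmbOn_toUnitBall.contDiffOn.comp hF fun _ _ => mem_univ _) _
    · simp only [he_def, Function.comp_apply, h0 0 (by norm_num) (mapsTo_torusIncl hp)]
    · simp only [he_def, Function.comp_apply, h1 1 (by norm_num) (mapsTo_torusIncl hp), hsφ p hp]
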